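/- Let $(T,r)$ be a compact metric tree, i.e. a non-empty compact metric space that satisfies the four point condition $$r(x_1,x_2)+r(x_3,x_4)\le\max\{r(x_1,x_3)+r(x_2,x_4),\ r(x_1,x_4)+r(x_2,x_3)\}\qquad(x_1,x_2,x_3,x_4\in T)$$ and in which any three points $x_1,x_2,x_3$ have a branch point $c\in T$, meaning $r(x_i,c)+r(x_j,c)=r(x_i,x_j)$ for all $i\neq j$ in $\{1,2,3\}$. Let $\nu$ be a finite Borel measure on $T$ with full support. Let $X$ and $Y$ be two (conservative) $T$-valued strong Markov processes with right-continuous (for instance càdlàg) paths. Each is given by the laws $(\mathbb P^x)_{x\in T}$ of the process started in $x$, on the space of right-continuous paths $[0,\infty)\to T$ with the $\sigma$-algebra generated by the evaluations. These laws depend measurably on $x$, and the strong Markov property is meant with respect to the usual (right-continuous, completed) augmentation of the natural filtration. For $y\in T$ let $\tau_y=\inf\{t\ge 0: X_t=y\}\in[0,\infty]$ be the first hitting time of $y$, and likewise for $Y$. Assume that for all $x,y\in T$ and all bounded measurable $f\colon T\to\mathbb R_+$, $$\mathbb E^x\Bigl[\int_0^{\tau_y}f(X_t)\,\mathrm dt\Bigr]=\mathbb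 E^x\Bigl[\int_0^{\tau_y}f(Y_t)\,\mathrm dt\Bigr]\quad\text{in }[0,\infty].$$ Assume further that for every $y\in T$ the process $X_{\cdot\wedge\tau_y}$ is transient, in the sense that there is a measurable function $g\colon T\to(0,\infty)$ with $\mathbb E^x\bigl[\int_0^{\tau_y}g(X_t)\,\mathrm dt\bigr]<\infty$ for all $x\in T$. Then the laws of $X$ and $Y$ agree: for every $x\in T$, the law of $X$ started in $x$ equals the law of $Y$ started in $x$. -/

import Mathlib

open MeasureTheory ProbabilityTheory
open scoped NNReal ENNReal

noncomputable section

/-- A metric tree: a non-empty metric space in which closed bounded sets are compact, which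
satisfies the four point condition and contains a branch point for any three of its points. -/
structure IsMetricTree (T : Type*) [MetricSpace T] : Prop where
  nonempty : Nonempty T
  heineBorel : ProperSpace T
  four_point : ∀ x₁ x₂ x₃ x₄ : T,
    dist x₁ x₂ + dist x₃ x₄ ≤ max (dist x₁ x₃ + dist x₂ x₄) (dist x₁ x₄ + dist x₂ x₃)
  fine : ∀ x₁ x₂ x₃ : T, ∃ c : T,
    dist x₁ c + dist x₂ c = dist x₁ x₂ ∧
    dist x₁ c + dist x₃ c = dist x₁ x₃ ∧
    dist x₂ c + dist x₃ c = dist x₂ x₃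

/-- The space of right-continuous paths `[0, ∞) → T`; in particular it contains all càdlàg
paths. -/
def RCPath (T : Type*) [TopologicalSpace T] : Type _ :=
  {w : ℝ≥0 → T // ∀ t, ContinuousWithinAt w (Set.Ici t) t}

namespace RCPath

variable {T : Type*} [TopologicalSpace T]

instance : CoeFun (RCPath T) (fun _ => ℝ≥0 → T) := ⟨fun w => w.1⟩

/-- The σ-algebra on path space generated by the evaluations `w ↦ w t`, `t ≥ 0`. -/
instance [MeasurableSpace T] : MeasurableSpace (RCPath T) :=
  ⨆ t : ℝ≥0, MeasurableSpace.comap (fun w : RCPath T => w t) inferInstance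

/-- The shifted path `t ↦ w (s + t)`. -/
def shift (s : ℝ≥0) (w : RCPath T) : RCPath T :=
  ⟨fun t => w (s + t), fun t => by
    have h : ContinuousWithinAt w.1 (Set.Ici (s + t)) (s + t) := w.2 (s + t)
    refine ContinuousWithinAt.comp (f := fun u : ℝ≥0 => s + u) h
      (by fun_prop) (fun u hu => ?_)
    exact add_le_add_right (Set.mem_Ici.mp hu) s⟩

/-- The σ-algebra `ℱ⁰_t` generated by the path up to time `t`. -/
@[reducible] def past [MeasurableSpace T] (t : ℝ≥0) : MeasurableSpace (RCPath T) :=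
  ⨆ s : ℝ≥0, ⨆ _ : s ≤ t, MeasurableSpace.comap (fun w : RCPath T => w s) inferInstance

/-- The right-continuous version `ℱ⁰_{t+} = ⋂_{s > t} ℱ⁰_s`. -/
@[reducible] def pastRight [MeasurableSpace T] (t : ℝ≥0) : MeasurableSpace (RCPath T) :=
  ⨅ s : ℝ≥0, ⨅ _ : t < s, past s

/-- The usual augmentation of the natural filtration under a measure `μ` on path space: the
events that agree, up to a `μ`-null set, with an event in `ℱ⁰_{t+}`. -/
@[reducible] def augmented [MeasurableSpace T] (μ : Measure (RCPath T)) (t : ℝ≥0) :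
    MeasurableSpace (RCPath T) :=
  eventuallyMeasurableSpace (pastRight t) (ae μ)

/-- Stopping times, possibly infinite, of the augmented filtration. -/
def IsStopping [MeasurableSpace T] (μ : Measure (RCPath T)) (τ : RCPath T → ℝ≥0∞) : Prop :=
  ∀ t : ℝ≥0, MeasurableSet[augmented μ t] {w | τ w ≤ t}

/-- On the event `τ < ∞`, the event `A` belongs to the past `ℱ_τ` of the stopping time `τ`. -/
def InPastOf [MeasurableSpace T] (μ : Measure (RCPath T)) (τ : RCPath T → ℝ≥0∞)
    (A : Set (RCPath T)) : Prop :=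
  ∀ t : ℝ≥0, MeasurableSet[augmented μ t] (A ∩ {w | τ w ≤ t})

/-- The first hitting time `τ_y = inf {t ≥ 0 : w t = y}`, equal to `∞` if `y` is not hit. -/
def hittingTime (y : T) (w : RCPath T) : ℝ≥0∞ :=
  ⨅ t : ℝ≥0, ⨅ _ : w t = y, (t : ℝ≥0∞)

end RCPath

/-- A `T`-valued strong Markov process with right-continuous paths, given by the laws `P x` on
path space of the process started in `x`, which depend measurably on `x`. The strong Markov
property says that for every stopping time `τ`, conditionally on `ℱ_τ` and on `τ < ∞`, the path
after time `τ` has law `P (w τ)`. -/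
structure IsStrongMarkovProcess {T : Type*} [TopologicalSpace T] [MeasurableSpace T]
    (P : Kernel T (RCPath T)) : Prop where
  isMarkovKernel : IsMarkovKernel P
  start : ∀ x, ∀ᵐ w ∂(P x), w 0 = x
  strongMarkov : ∀ (x : T) (τ : RCPath T → ℝ≥0∞), RCPath.IsStopping (P x) τ →
    ∀ A : Set (RCPath T), RCPath.InPastOf (P x) τ A →
    ∀ B : Set (RCPath T), MeasurableSet B →
      P x {w | w ∈ A ∧ τ w < ∞ ∧ RCPath.shift (τ w).toNNReal w ∈ B} =
        ∫⁻ w in A ∩ {w | τ w < ∞}, P (w (τ w).toNNReal) B ∂(P x)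

/-- The expected occupation time functional `𝔼^x [∫₀^{τ_y} f (X_t) dt]`, with values in
`[0, ∞]`. -/
def expectedOccupation {T : Type*} [TopologicalSpace T] [MeasurableSpace T]
    (P : Kernel T (RCPath T)) (x y : T) (f : T → ℝ≥0) : ℝ≥0∞ :=
  ∫⁻ w, (∫⁻ t in {t : ℝ | 0 ≤ t ∧ ENNReal.ofReal t < RCPath.hittingTime y w},
    (f (w t.toNNReal) : ℝ≥0∞)) ∂(P x)

/-- Transience of the process run until it hits `y` (the point `y` being the cemetery): some
strictly positive measurable function has a finite potential everywhere. -/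
def IsTransientUntilHitting {T : Type*} [TopologicalSpace T] [MeasurableSpace T]
    (P : Kernel T (RCPath T)) (y : T) : Prop :=
  ∃ g : T → ℝ≥0, Measurable g ∧ (∀ z, 0 < g z) ∧ ∀ x, expectedOccupation P x y g < ∞

end

noncomputable section

open Set Filter Topology

/-! Write U for the potential kernel of the process killed at `y`, U_a for its resolvent, R_a for
the resolvent of the unkilled process, and φ_a(x, y) for the Laplace transform of the hitting time
of `y` from `x`. The hypothesis on occupation times says that P and Q share U for every `y`. The
resolvent equation U = U_a + a U_a U recovers U_a from U wherever potentials are finite, and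
transience provides enough such functions (`killedOccupation_expTime_congr`).

The strong Markov property at the hitting time gives R_a f(x) = U_a f(x) + φ_a(x, y) R_a f(y). For f
= 1 this determines φ_a, since R_a 1 is the same constant for both processes. For two distinct
points x and z, inserting the decomposition from z to x into the one from x to z gives an affine
equation for R_a f(x) with slope φ_a(x, z) φ_a(z, x) < 1, so R_a f is determined
(`markovResolvent_congr`). Uniqueness of Laplace transforms together with right-continuity yields
the one-dimensional distributions, and the Markov property yields the law.

The technical burden is measurability. The event that `y` is hit before time t is the preimage of an
analytic set, so it is handled only up to null sets. Functionals built from hitting times are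
accordingly treated as universally measurable, a class that is stable under the integrations needed.
-/

/-! ### Universal measurability of analytic sets -/

theorem isCompact_setOf_forall_le (b : ℕ → ℕ) : IsCompact {x : ℕ → ℕ | ∀ i, x i ≤ b i} := by
  have : {x : ℕ → ℕ | ∀ i, x i ≤ b i} = Set.pi univ fun i => Iic (b i) := by
    ext x
    simp only [mem_ofPred_eq, Set.mem_pi, mem_univ, mem_Iic, true_imp_iff]
  rw [this]
  exact isCompact_univ_pi fun i => (finite_Iic (b i)).isCompact

/-- An open neighbourhood of the box `{x | ∀ i, x i ≤ b i}` contains all sequences that obey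
the bound in sufficiently many coordinates. -/
theorem exists_forall_lt_le_subset_of_isOpen {b : ℕ → ℕ} {U : Set (ℕ → ℕ)} (hU : IsOpen U)
    (hb : {x | ∀ i, x i ≤ b i} ⊆ U) : ∃ n, {x : ℕ → ℕ | ∀ i < n, x i ≤ b i} ⊆ U := by
  by_contra! h
  simp only [not_subset] at h
  choose x hx hxU using h
  obtain ⟨a, ha, φ, hφ, hlim⟩ := (isCompact_setOf_forall_le b).tendsto_subseq
    (x := fun n i => min (x n i) (b i)) (fun n i => min_le_right _ _)
  refine (hU.isClosed_compl.mem_of_tendsto (b := atTop) (f := x ∘ φ) (x := a) ?_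
    (Eventually.of_forall fun n => hxU (φ n))) (hb ha)
  rw [tendsto_pi_nhds] at hlim ⊢
  intro i
  refine (hlim i).congr' ?_
  filter_upwards [hφ.tendsto_atTop.eventually_gt_atTop i] with n hn
  simpa using hx (φ n) i hn

/-- Coordinates are bounded one at a time: as the bound on coordinate n grows, the images increase
to the previous one. Continuity from below along increasing sets needs no measurability, so a large
enough bound keeps the measure above c. -/
theorem exists_bound_lt_measure_image {α : Type*} [MeasurableSpace α] (μ : Measure α)
    (f : (ℕ → ℕ) → α) {c : ℝ≥0∞} (hc : c < μ (range f)) :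
    ∃ b : ℕ → ℕ, ∀ n, c < μ (f '' {x | ∀ i < n, x i ≤ b i}) := by
  have step : ∀ n (β : ℕ → ℕ), c < μ (f '' {x | ∀ i < n, x i ≤ β i}) →
      ∃ k, c < μ (f '' {x | ∀ i < n + 1, x i ≤ Function.update β n k i}) := by
    intro n β h
    have hU : f '' {x | ∀ i < n, x i ≤ β i} =
        ⋃ k, f '' {x | ∀ i < n + 1, x i ≤ Function.update β n k i} := by
      rw [← image_iUnion]
      congr 1
      ext x
      simp only [mem_ofPred_eq, mem_iUnion]
      constructor
      · intro hx
        refine ⟨x n, fun i hi => ?_⟩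
        rcases eq_or_ne i n with rfl | hin
        · simp
        · rw [Function.update_of_ne hin]
          exact hx i (by omega)
      · rintro ⟨k, hk⟩ i hi
        have := hk i (by omega)
        rwa [Function.update_of_ne hi.ne] at this
    have hmono : Monotone fun k => f '' {x | ∀ i < n + 1, x i ≤ Function.update β n k i} := by
      intro k l hkl
      refine image_mono fun x hx i hi => (hx i hi).trans ?_
      rcases eq_or_ne i n with rfl | hin
      · simpa using hkl
      · simp [Function.update_of_ne hin]
    rw [hU, hmono.measure_iUnion] at h
    exact lt_iSup_iff.mp h
  have h0 : c < μ (f '' {x | ∀ i < 0, x i ≤ (0 : ℕ → ℕ) i}) := by simpa using hc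
  let S := fun n => {β : ℕ → ℕ // c < μ (f '' {x | ∀ i < n, x i ≤ β i})}
  let B : ∀ n, S n := fun n => Nat.rec ⟨0, h0⟩
    (fun n β => ⟨Function.update β.1 n (step n β.1 β.2).choose,
      (step n β.1 β.2).choose_spec⟩) n
  have hB : ∀ n i, i < n → (B n).1 i = (B (i + 1)).1 i := by
    intro n i hi
    induction n with
    | zero => omega
    | succ n ih =>
      rcases eq_or_ne i n with rfl | hin
      · rfl
      · rw [← ih (by omega)]
        exact Function.update_of_ne hin _ _
  refine ⟨fun i => (B (i + 1)).1 i, fun n => ?_⟩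
  have : {x : ℕ → ℕ | ∀ i < n, x i ≤ (B (i + 1)).1 i} = {x | ∀ i < n, x i ≤ (B n).1 i} := by
    ext x
    exact forall₂_congr fun i hi => by rw [hB n i hi]
  rw [this]
  exact (B n).2

/-- Analytic sets are measurable with respect to the completion of every finite Borel measure. -/
theorem MeasureTheory.AnalyticSet.nullMeasurableSet {α : Type*} [TopologicalSpace α]
    [PolishSpace α] [MeasurableSpace α] [BorelSpace α] {A : Set α} (hA : AnalyticSet A)
    (μ : Measure α) [IsFiniteMeasure μ] : NullMeasurableSet A μ := by
  rw [AnalyticSet] at hA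
  rcases hA with rfl | ⟨f, hf, rfl⟩
  · exact MeasurableSet.empty.nullMeasurableSet
  -- Inner approximation by the compact image of a box. Every open set around it contains the image
  -- of a set that restricts only finitely many coordinates, hence has measure above c; outer
  -- regularity passes this to the compact set.
  have key : ∀ c < μ (range f), ∃ K ⊆ range f, MeasurableSet K ∧ c ≤ μ K := by
    intro c hc
    obtain ⟨b, hb⟩ := exists_bound_lt_measure_image μ f hc
    refine ⟨f '' {x | ∀ i, x i ≤ b i}, image_subset_range _ _,
      ((isCompact_setOf_forall_le b).image hf).measurableSet, ?_⟩
    rw [Set.measure_eq_iInf_isOpen]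
    refine le_iInf₂ fun U hKU => le_iInf fun hU => ?_
    obtain ⟨n, hn⟩ := exists_forall_lt_le_subset_of_isOpen (hU.preimage hf)
      (image_subset_iff.mp hKU)
    exact (hb n).le.trans (measure_mono (image_subset_iff.mpr hn))
  rcases eq_or_ne (μ (range f)) 0 with h0 | h0
  · exact NullMeasurableSet.of_null h0
  obtain ⟨c, -, hc, hlim⟩ := exists_seq_strictMono_tendsto' (pos_iff_ne_zero.mpr h0)
  choose K hKsub hKm hKc using fun n => key (c n) (hc n).2
  have hsub : ⋃ n, K n ⊆ range f := iUnion_subset hKsub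
  have hle : μ (range f) ≤ μ (⋃ n, K n) :=
    le_of_tendsto' hlim fun n => (hKc n).trans (measure_mono (subset_iUnion K n))
  have hm : MeasurableSet (⋃ n, K n) := MeasurableSet.iUnion hKm
  exact hm.nullMeasurableSet.congr
    (ae_eq_of_subset_of_measure_ge hsub hle hm.nullMeasurableSet (measure_ne_top _ _))

/-! ### Path space and hitting times -/

namespace RCPath

section Evaluation

variable {T : Type*} [TopologicalSpace T] [MeasurableSpace T]

theorem measurable_eval (t : ℝ≥0) : Measurable fun w : RCPath T => w t :=
  Measurable.of_comap_le (le_iSup (fun t : ℝ≥0 =>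
    MeasurableSpace.comap (fun w : RCPath T => w t) inferInstance) t)

theorem measurable_of_eval {α : Type*} [MeasurableSpace α] {f : α → RCPath T}
    (hf : ∀ t, Measurable fun a => f a t) : Measurable f := by
  rw [measurable_iff_comap_le, instMeasurableSpace, MeasurableSpace.comap_iSup]
  refine iSup_le fun t => ?_
  rw [MeasurableSpace.comap_comp]
  exact (hf t).comap_le

theorem measurable_eval_past {s t : ℝ≥0} (h : s ≤ t) :
    Measurable[past t] fun w : RCPath T => w s :=
  Measurable.of_comap_le (le_iSup₂ (f := fun (s : ℝ≥0) (_ : s ≤ t) =>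
    MeasurableSpace.comap (fun w : RCPath T => w s) inferInstance) s h)

theorem past_mono {s t : ℝ≥0} (h : s ≤ t) : past (T := T) s ≤ past t :=
  iSup₂_le fun u hu => le_iSup₂ (f := fun (s : ℝ≥0) (_ : s ≤ t) =>
    MeasurableSpace.comap (fun w : RCPath T => w s) inferInstance) u (hu.trans h)

theorem past_le (t : ℝ≥0) : past (T := T) t ≤ instMeasurableSpace :=
  iSup₂_le fun u _ => (measurable_eval u).comap_le

theorem pastRight_mono {s t : ℝ≥0} (h : s ≤ t) : pastRight (T := T) s ≤ pastRight t :=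
  le_iInf₂ fun u hu => iInf₂_le u (h.trans_lt hu)

theorem pastRight_le (t : ℝ≥0) : pastRight (T := T) t ≤ instMeasurableSpace :=
  (iInf₂_le (t + 1) (lt_add_one t)).trans (past_le _)

theorem augmented_mono (μ : Measure (RCPath T)) {s t : ℝ≥0} (h : s ≤ t) :
    augmented μ s ≤ augmented μ t := by
  rintro A ⟨B, hB, hAB⟩
  exact ⟨B, pastRight_mono h B hB, hAB⟩

theorem nullMeasurableSet_of_augmented {μ : Measure (RCPath T)} {t : ℝ≥0} {A : Set (RCPath T)}
    (hA : MeasurableSet[augmented μ t] A) : NullMeasurableSet A μ := by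
  obtain ⟨B, hB, hAB⟩ := hA
  exact (pastRight_le t B hB).nullMeasurableSet.congr hAB.symm

end Evaluation

/-- The points of the grid of mesh `1 / (n + 1)` in `(0, ∞)`. -/
def gridTime (n k : ℕ) : ℝ≥0 := (k + 1) / (n + 1)

/-- This is the first grid point strictly to the right of s; right-continuous paths can only be
approximated from that side. -/
theorem lt_gridTime (n : ℕ) (s : ℝ≥0) : s < gridTime n ⌊s * (n + 1)⌋₊ := by
  rw [gridTime, lt_div_iff₀ (by positivity)]
  exact Nat.lt_floor_add_one _

theorem gridTime_le (n : ℕ) (s : ℝ≥0) : gridTime n ⌊s * (n + 1)⌋₊ ≤ s + 1 / (n + 1) := by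
  have h : (⌊s * (n + 1)⌋₊ : ℝ≥0) ≤ s * (n + 1) := Nat.floor_le (by positivity)
  rw [gridTime, div_le_iff₀ (by positivity), add_mul, div_mul_cancel₀ _ (by positivity)]
  gcongr

theorem tendsto_gridTime (s : ℝ≥0) :
    Tendsto (fun n : ℕ => gridTime n ⌊s * (n + 1)⌋₊) atTop (𝓝 s) := by
  refine tendsto_of_tendsto_of_tendsto_of_le_of_le tendsto_const_nhds ?_
    (fun n => (lt_gridTime n s).le) (fun n => gridTime_le n s)
  have : Tendsto (fun n : ℕ => (1 : ℝ≥0) / (n + 1)) atTop (𝓝 0) :=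
    tendsto_one_div_add_atTop_nhds_zero_nat
  simpa using this.const_add s

section Topological

variable {T : Type*} [TopologicalSpace T]

theorem tendsto_eval (w : RCPath T) {s : ℝ≥0} {u : ℕ → ℝ≥0} (hu : Tendsto u atTop (𝓝 s))
    (hs : ∀ n, s ≤ u n) : Tendsto (fun n => w (u n)) atTop (𝓝 (w s)) :=
  Tendsto.comp (w.2 s) (tendsto_nhdsWithin_iff.mpr ⟨hu, Eventually.of_forall hs⟩)

theorem hittingTime_lt_iff {y : T} {w : RCPath T} {t : ℝ≥0∞} :
    hittingTime y w < t ↔ ∃ s : ℝ≥0, (s : ℝ≥0∞) < t ∧ w s = y := by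
  simp only [hittingTime, iInf_lt_iff, exists_prop, and_comm]

theorem hittingTime_le {y : T} {w : RCPath T} {s : ℝ≥0} (h : w s = y) :
    hittingTime y w ≤ s :=
  iInf₂_le s h

/-- The infimum is attained: times of visits to `y` approach it from the right, and the path is
right-continuous. -/
theorem apply_hittingTime [T1Space T] {y : T} {w : RCPath T} (h : hittingTime y w < ∞) :
    w (hittingTime y w).toNNReal = y := by
  set σ := (hittingTime y w).toNNReal with hσ
  have hσ' : (σ : ℝ≥0∞) = hittingTime y w := ENNReal.coe_toNNReal h.ne
  have hex : ∀ n : ℕ, ∃ s : ℝ≥0, s < σ + 1 / (n + 1) ∧ w s = y := fun n => by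
    have : hittingTime y w < ((σ + 1 / (n + 1) : ℝ≥0) : ℝ≥0∞) := by
      rw [← hσ']
      exact_mod_cast lt_add_of_pos_right σ (by positivity)
    obtain ⟨s, hs, hsy⟩ := hittingTime_lt_iff.mp this
    exact ⟨s, by exact_mod_cast hs, hsy⟩
  choose s hs hsy using hex
  have hle : ∀ n, σ ≤ s n := fun n => by
    have := hittingTime_le (hsy n)
    rw [← hσ'] at this
    exact_mod_cast this
  have hlim : Tendsto s atTop (𝓝 σ) := by
    refine tendsto_of_tendsto_of_tendsto_of_le_of_le tendsto_const_nhds ?_ hle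
      (fun n => (hs n).le)
    have : Tendsto (fun n : ℕ => (1 : ℝ≥0) / (n + 1)) atTop (𝓝 0) :=
      tendsto_one_div_add_atTop_nhds_zero_nat
    simpa using this.const_add σ
  have := tendsto_eval w hlim hle
  simp only [hsy] at this
  exact (tendsto_const_nhds_iff.mp this).symm

theorem hittingTime_eq_add {y : T} {w : RCPath T} {t : ℝ≥0} (h : (t : ℝ≥0∞) ≤ hittingTime y w) :
    hittingTime y w = t + hittingTime y (shift t w) := by
  refine le_antisymm ?_ ?_
  · refine le_of_forall_gt fun c hc => ?_
    have : hittingTime y (shift t w) < c - t := lt_tsub_iff_left.mpr hc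
    obtain ⟨s, hs, hsy⟩ := hittingTime_lt_iff.mp this
    refine hittingTime_lt_iff.mpr ⟨t + s, ?_, hsy⟩
    exact_mod_cast lt_tsub_iff_left.mp hs
  · refine le_of_forall_gt fun c hc => ?_
    obtain ⟨s, hs, hsy⟩ := hittingTime_lt_iff.mp hc
    have hts : t ≤ s := by exact_mod_cast h.trans (hittingTime_le hsy)
    refine lt_of_le_of_lt ?_ hs
    have : hittingTime y (shift t w) ≤ ((s - t : ℝ≥0) : ℝ≥0∞) := by
      refine hittingTime_le ?_
      change w (t + (s - t)) = y
      rwa [add_tsub_cancel_of_le hts]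
    calc (t : ℝ≥0∞) + hittingTime y (shift t w) ≤ t + ((s - t : ℝ≥0) : ℝ≥0∞) := by gcongr
      _ = s := by rw [← ENNReal.coe_add, add_tsub_cancel_of_le hts]

theorem hittingTime_pos [T1Space T] {y : T} {w : RCPath T} (h : w 0 ≠ y) :
    0 < hittingTime y w := by
  rw [pos_iff_ne_zero]
  intro h0
  have := apply_hittingTime (y := y) (w := w) (by simp [h0])
  rw [h0] at this
  exact h this

/-- The values of a path on the grids of all meshes, up to time `t`. -/
def gridValues (t : ℝ≥0) (w : RCPath T) : ℕ × ℕ → T :=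
  fun p => w (min (gridTime p.1 p.2) t)

theorem measurable_gridValues [MeasurableSpace T] (t : ℝ≥0) :
    Measurable[past t] (gridValues (T := T) t) :=
  @measurable_pi_lambda _ _ _ (past t) _ _ fun _ => measurable_eval_past (min_le_right _ _)

end Topological

section Metrizable

variable {T : Type*} [MetricSpace T] [MeasurableSpace T] [BorelSpace T]

/-- By right-continuity, evaluation is the pointwise limit of reading the path at the next grid
point, which involves only countably many times. -/
theorem measurable_uncurry_eval : Measurable fun q : ℝ≥0 × RCPath T => q.2 q.1 := by
  refine measurable_of_tendsto_metrizable
    (f := fun (n : ℕ) (q : ℝ≥0 × RCPath T) => q.2 (gridTime n ⌊q.1 * (n + 1)⌋₊)) (fun n => ?_) ?_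
  · have h1 : Measurable fun p : ℕ × RCPath T => p.2 (gridTime n p.1) :=
      measurable_from_prod_countable_right fun k => measurable_eval (gridTime n k)
    exact h1.comp (f := fun q : ℝ≥0 × RCPath T => (⌊q.1 * (n + 1)⌋₊, q.2))
      (((Nat.measurable_floor).comp (by fun_prop)).prodMk measurable_snd)
  · rw [tendsto_pi_nhds]
    exact fun q => tendsto_eval q.2 (tendsto_gridTime q.1) fun n => (lt_gridTime n q.1).le

theorem measurable_uncurry_shift : Measurable fun q : ℝ≥0 × RCPath T => shift q.1 q.2 :=
  measurable_of_eval fun t => measurable_uncurry_eval.comp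
    (f := fun q : ℝ≥0 × RCPath T => (q.1 + t, q.2)) (by fun_prop)

theorem measurable_shift (s : ℝ≥0) : Measurable (shift (T := T) s) :=
  measurable_uncurry_shift.comp measurable_prodMk_left

variable [CompactSpace T]

/-- The event that `y` is hit before time `t` agrees, up to a null set, with an event of the past
of `t`: it is the preimage of an analytic set under the grid values. -/
theorem exists_past_ae_eq_hittingTime_lt (μ : Measure (RCPath T)) [IsFiniteMeasure μ] (y : T)
    (t : ℝ≥0) : ∃ C, MeasurableSet[past t] C ∧ {w | hittingTime y w < t} =ᵐ[μ] C := by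
  -- Path space is replaced by the Polish space of grid values. A pair (s, u) is in `B` if the
  -- values u converge to `y` at s from the right; projecting s away gives an analytic set.
  let B : Set (ℝ≥0 × (ℕ × ℕ → T)) := {q | q.1 < t ∧
    Tendsto (fun n : ℕ => q.2 (n, ⌊q.1 * (n + 1)⌋₊)) atTop (𝓝 y)}
  have hB : MeasurableSet B := by
    refine (measurableSet_lt measurable_fst measurable_const).inter
      (measurableSet_tendsto (𝓝 y) fun n => ?_)
    have h1 : Measurable fun p : ℕ × (ℕ × ℕ → T) => p.2 (n, p.1) :=
      measurable_from_prod_countable_right fun k => measurable_pi_apply (n, k)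
    exact h1.comp (f := fun q : ℝ≥0 × (ℕ × ℕ → T) => (⌊q.1 * (n + 1)⌋₊, q.2))
      (((Nat.measurable_floor).comp (by fun_prop)).prodMk measurable_snd)
  have hA : AnalyticSet (Prod.snd '' B) := hB.analyticSet_image measurable_snd
  have hm : Measurable (gridValues (T := T) t) :=
    (measurable_gridValues t).mono (past_le t) le_rfl
  obtain ⟨C, hC, hAC⟩ := hA.nullMeasurableSet (μ.map (gridValues t))
  refine ⟨gridValues t ⁻¹' C, measurable_gridValues t hC, ?_⟩
  have heq : {w : RCPath T | hittingTime y w < t} = gridValues t ⁻¹' (Prod.snd '' B) := by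
    have hlim : ∀ (w : RCPath T) (s : ℝ≥0), s < t →
        Tendsto (fun n : ℕ => gridValues t w (n, ⌊s * (n + 1)⌋₊)) atTop (𝓝 (w s)) := by
      intro w s hs
      refine tendsto_eval w ?_ fun n => le_min (lt_gridTime n s).le hs.le
      simpa [min_eq_left hs.le] using (tendsto_gridTime s).min (tendsto_const_nhds (x := t))
    ext w
    simp only [mem_ofPred_eq, mem_preimage, mem_image, hittingTime_lt_iff]
    constructor
    · rintro ⟨s, hs, rfl⟩
      have hs' : s < t := by exact_mod_cast hs
      exact ⟨(s, gridValues t w), ⟨hs', hlim w s hs'⟩, rfl⟩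
    · rintro ⟨⟨s, u⟩, ⟨hs, hu⟩, rfl⟩
      exact ⟨s, by exact_mod_cast hs, tendsto_nhds_unique (hlim w s hs) hu⟩
  rw [heq]
  exact (hm.quasiMeasurePreserving μ).preimage_ae_eq hAC

/-- Being hit by time t means being hit before t + 1/(n+1) for infinitely many n. A limsup ignores
initial terms, so it belongs to the past of every s > t. -/
theorem isStopping_hittingTime (μ : Measure (RCPath T)) [IsFiniteMeasure μ] (y : T) :
    IsStopping μ (hittingTime y) := by
  intro t
  choose C hC hCeq using fun n : ℕ => exists_past_ae_eq_hittingTime_lt μ y (t + 1 / (n + 1))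
  refine ⟨limsup C atTop, ?_, ?_⟩
  · rw [MeasurableSpace.measurableSet_iInf]
    intro s
    rw [MeasurableSpace.measurableSet_iInf]
    intro hs
    have h0 : Tendsto (fun n : ℕ => t + (1 : ℝ≥0) / (n + 1)) atTop (𝓝 t) := by
      have : Tendsto (fun n : ℕ => (1 : ℝ≥0) / (n + 1)) atTop (𝓝 0) :=
        tendsto_one_div_add_atTop_nhds_zero_nat
      simpa using this.const_add t
    obtain ⟨N, hN⟩ := eventually_atTop.mp (h0.eventually_lt_const hs)
    rw [← limsup_nat_add C N]
    exact @MeasurableSet.measurableSet_limsup _ (past s) _ fun n =>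
      past_mono (hN (n + N) (by omega)).le _ (hC (n + N))
  · have hall : ∀ᵐ w ∂μ, ∀ n : ℕ, hittingTime y w < (t + 1 / (n + 1) : ℝ≥0) ↔ w ∈ C n :=
      ae_all_iff.mpr fun n => (hCeq n).mem_iff
    refine eventuallyEq_set.mpr ?_
    filter_upwards [hall] with w hw
    rw [mem_limsup_iff_frequently_mem]
    simp only [← hw]
    constructor
    · intro h
      refine Frequently.of_forall fun n => h.trans_lt ?_
      exact_mod_cast lt_add_of_pos_right t (by positivity)
    · intro h
      have h0 : Tendsto (fun n : ℕ => ((t + (1 : ℝ≥0) / (n + 1) : ℝ≥0) : ℝ≥0∞)) atTop (𝓝 t) := by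
        have : Tendsto (fun n : ℕ => (1 : ℝ≥0) / (n + 1)) atTop (𝓝 0) :=
          tendsto_one_div_add_atTop_nhds_zero_nat
        exact ENNReal.tendsto_coe.mpr (by simpa using this.const_add t)
      by_contra! hlt
      exact h ((h0.eventually_lt_const hlt).mono fun n hn => hn.le.not_gt)

theorem aemeasurable_hittingTime (μ : Measure (RCPath T)) [IsFiniteMeasure μ] (y : T) :
    AEMeasurable (hittingTime y) μ := by
  refine ENNReal.aemeasurable_of_exist_almost_disjoint_supersets μ _ fun p q hpq => ?_
  have hn : NullMeasurableSet {w | hittingTime y w ≤ p} μ :=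
    nullMeasurableSet_of_augmented (isStopping_hittingTime μ y p)
  refine ⟨toMeasurable μ {w | hittingTime y w ≤ p}, toMeasurable μ {w | hittingTime y w ≤ p}ᶜ,
    measurableSet_toMeasurable _ _, measurableSet_toMeasurable _ _,
    Subset.trans (fun w hw => ?_) (subset_toMeasurable _ _),
    Subset.trans (fun w hw => ?_) (subset_toMeasurable _ _), ?_⟩
  · exact le_of_lt (show hittingTime y w < p from hw)
  · exact fun h => (lt_of_le_of_lt h (ENNReal.coe_lt_coe.mpr hpq)).not_gt hw
  · rw [measure_congr (hn.toMeasurable_ae_eq.inter hn.compl.toMeasurable_ae_eq)]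
    simp

end Metrizable

end RCPath

/-! ### Universally measurable functions -/

/-- A function that is almost everywhere measurable with respect to every finite measure. -/
def UniversallyMeasurable {α β : Type*} [MeasurableSpace α] [MeasurableSpace β] (f : α → β) :
    Prop :=
  ∀ (μ : Measure α) [IsFiniteMeasure μ], AEMeasurable f μ

namespace UniversallyMeasurable

variable {α β γ : Type*} [MeasurableSpace α] [MeasurableSpace β] [MeasurableSpace γ]

theorem of_measurable {f : α → β} (hf : Measurable f) : UniversallyMeasurable f :=
  fun _ _ => hf.aemeasurable

theorem aemeasurable {f : α → β} (hf : UniversallyMeasurable f) (μ : Measure α) [SFinite μ] :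
    AEMeasurable f μ :=
  (hf μ.toFinite).mono_ac (absolutelyContinuous_toFinite μ)

theorem comp {f : β → γ} (hf : UniversallyMeasurable f) {φ : α → β} (hφ : Measurable φ) :
    UniversallyMeasurable fun a => f (φ a) :=
  fun μ _ => (hf (μ.map φ)).comp_measurable hφ

theorem mul {f g : α → ℝ≥0∞} (hf : UniversallyMeasurable f) (hg : UniversallyMeasurable g) :
    UniversallyMeasurable fun a => f a * g a :=
  fun μ _ => (hf μ).mul (hg μ)

theorem lintegral_prod {f : α × β → ℝ≥0∞} (hf : UniversallyMeasurable f) (m : Measure β)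
    [SFinite m] : UniversallyMeasurable fun a => ∫⁻ b, f (a, b) ∂m :=
  fun μ _ => (hf.aemeasurable (μ.prod m)).lintegral_prod_right'

/-- A Borel modification with respect to the mixture `μ.bind κ` is a modification for `κ a` at
`μ`-almost every a. -/
theorem lintegral_kernel {f : β → ℝ≥0∞} (hf : UniversallyMeasurable f) (κ : Kernel α β)
    [IsMarkovKernel κ] : UniversallyMeasurable fun a => ∫⁻ b, f b ∂(κ a) := by
  intro μ _
  have h : AEMeasurable f (μ.bind κ) := hf _
  refine ⟨fun a => ∫⁻ b, h.mk f b ∂(κ a), h.measurable_mk.lintegral_kernel, ?_⟩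
  filter_upwards [Measure.ae_ae_of_ae_bind κ.aemeasurable h.ae_eq_mk] with a ha
  exact lintegral_congr_ae ha

end UniversallyMeasurable

/-! ### Killing along a path and the Markov property at fixed times -/

section Paths

open RCPath

/-- The indicator of being alive at time `t`, if `r` is the killing time. -/
def aliveAt (t r : ℝ≥0∞) : ℝ≥0∞ := if t < r then 1 else 0

theorem measurable_aliveAt : Measurable fun p : ℝ≥0∞ × ℝ≥0∞ => aliveAt p.1 p.2 :=
  Measurable.ite (measurableSet_lt measurable_fst measurable_snd) measurable_const measurable_const

section KilledValue

variable {T : Type*} [TopologicalSpace T]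

/-- The value of `f` along the path before the path hits `y`, and zero afterwards. -/
def killedValue (y : T) (f : T → ℝ≥0∞) (t : ℝ≥0) (w : RCPath T) : ℝ≥0∞ :=
  aliveAt t (hittingTime y w) * f (w t)

/-- Before `y` is hit, the remaining time to hit it is the hitting time of the shifted path. This
pathwise identity is the source of the killed semigroup property. -/
theorem killedValue_add (y : T) (f : T → ℝ≥0∞) (t s : ℝ≥0) (w : RCPath T) :
    killedValue y f (t + s) w =
      aliveAt t (hittingTime y w) * killedValue y f s (shift t w) := by
  rw [killedValue, killedValue, ← mul_assoc]
  congr 1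
  simp only [aliveAt]
  by_cases h : (t : ℝ≥0∞) < hittingTime y w
  · rw [if_pos h, one_mul, hittingTime_eq_add h.le, ENNReal.coe_add]
    simp only [ENNReal.add_lt_add_iff_left ENNReal.coe_ne_top]
  · rw [if_neg h, zero_mul, if_neg]
    exact fun h' => h (lt_of_le_of_lt (ENNReal.coe_le_coe.mpr le_self_add) h')

end KilledValue

variable {T : Type*} [MetricSpace T] [MeasurableSpace T] [BorelSpace T] {P : Kernel T (RCPath T)}

/-- The Markov property at a fixed time. -/
theorem IsStrongMarkovProcess.map_shift (hP : IsStrongMarkovProcess P) (x : T) (t : ℝ≥0)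
    {A : Set (RCPath T)} (hA : MeasurableSet[augmented (P x) t] A) :
    ((P x).restrict A).map (shift t) = (((P x).restrict A).map fun w => w t).bind P := by
  ext B hB
  have hconst : IsStopping (P x) fun _ => (t : ℝ≥0∞) := by
    intro s
    exact @MeasurableSet.const _ (augmented (P x) s) _
  have hpast : InPastOf (P x) (fun _ => (t : ℝ≥0∞)) A := by
    intro s
    by_cases hts : t ≤ s
    · have : A ∩ {w | (t : ℝ≥0∞) ≤ s} = A := by
        ext w
        simp [hts]
      rw [this]
      exact augmented_mono _ hts _ hA
    · have : A ∩ {w | (t : ℝ≥0∞) ≤ s} = ∅ := by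
        ext w
        simp [hts]
      rw [this]
      exact @MeasurableSet.empty _ (augmented (P x) s)
  have h := hP.strongMarkov x (fun _ => t) hconst A hpast B hB
  rw [Measure.map_apply (measurable_shift t) hB, Measure.bind_apply hB P.aemeasurable,
    lintegral_map (P.measurable_coe hB) (measurable_eval t),
    Measure.restrict_apply (measurable_shift t hB)]
  simp only [ENNReal.coe_lt_top, true_and, ENNReal.toNNReal_coe, ofPred_true, inter_univ] at h
  rw [inter_comm]
  exact h

/-- The Markov property at a fixed time, for universally measurable functionals. -/
theorem IsStrongMarkovProcess.lintegral_shift [IsMarkovKernel P] (hP : IsStrongMarkovProcess P)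
    (x : T) (t : ℝ≥0) {A : Set (RCPath T)} (hA : MeasurableSet[augmented (P x) t] A)
    {Φ : RCPath T → ℝ≥0∞} (hΦ : UniversallyMeasurable Φ) :
    ∫⁻ w in A, Φ (shift t w) ∂(P x) = ∫⁻ w in A, ∫⁻ v, Φ v ∂(P (w t)) ∂(P x) := by
  rw [← lintegral_map' (hΦ _) (measurable_shift t).aemeasurable, hP.map_shift x t hA,
    Measure.lintegral_bind P.aemeasurable (hΦ _),
    lintegral_map' (hΦ.lintegral_kernel P _) (measurable_eval t).aemeasurable]

end Paths

/-! ### Occupation measures of the killed process -/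

section Killed

variable {T : Type*} [MetricSpace T] [CompactSpace T] [MeasurableSpace T] [BorelSpace T]

open RCPath

theorem universallyMeasurable_hittingTime (y : T) :
    UniversallyMeasurable (hittingTime y) :=
  fun μ _ => aemeasurable_hittingTime μ y

theorem universallyMeasurable_aliveAt (y : T) :
    UniversallyMeasurable fun q : ℝ≥0 × RCPath T => aliveAt q.1 (hittingTime y q.2) := fun μ _ =>
  measurable_aliveAt.comp_aemeasurable
    (AEMeasurable.prodMk (measurable_fst.coe_nnreal_ennreal.aemeasurable)
      ((universallyMeasurable_hittingTime y).comp measurable_snd μ))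

theorem universallyMeasurable_killedValue (y : T) {f : T → ℝ≥0∞} (hf : UniversallyMeasurable f) :
    UniversallyMeasurable fun q : ℝ≥0 × RCPath T => killedValue y f q.1 q.2 :=
  (universallyMeasurable_aliveAt y).mul (hf.comp measurable_uncurry_eval)

/-- The expected time, measured by `m`, which the process started in `x` spends in subsets of `T`
before it hits `y`. -/
def killedOccupation (m : Measure ℝ≥0) (P : Kernel T (RCPath T)) (y x : T) : Measure T :=
  ((m.prod (P x)).withDensity fun q => aliveAt q.1 (hittingTime y q.2)).map fun q => q.2 q.1

instance (m : Measure ℝ≥0) [SFinite m] (P : Kernel T (RCPath T)) [IsMarkovKernel P] (y x : T) :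
    SFinite (killedOccupation m P y x) := by
  unfold killedOccupation
  infer_instance

variable {P : Kernel T (RCPath T)} [IsMarkovKernel P]

theorem lintegral_killedOccupation (m : Measure ℝ≥0) [SFinite m] (y x : T) {f : T → ℝ≥0∞}
    (hf : UniversallyMeasurable f) :
    ∫⁻ z, f z ∂killedOccupation m P y x = ∫⁻ t, ∫⁻ w, killedValue y f t w ∂(P x) ∂m := by
  rw [killedOccupation, lintegral_map' (hf.aemeasurable _) measurable_uncurry_eval.aemeasurable,
    lintegral_withDensity_eq_lintegral_mul₀ ((universallyMeasurable_aliveAt y).aemeasurable _)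
      ((hf.comp measurable_uncurry_eval).aemeasurable _),
    ← lintegral_prod _ ((universallyMeasurable_killedValue y hf).aemeasurable _)]
  rfl

theorem lintegral_killedOccupation' (m : Measure ℝ≥0) [SFinite m] (y x : T) {f : T → ℝ≥0∞}
    (hf : UniversallyMeasurable f) :
    ∫⁻ z, f z ∂killedOccupation m P y x = ∫⁻ w, ∫⁻ t, killedValue y f t w ∂m ∂(P x) := by
  rw [lintegral_killedOccupation m y x hf, lintegral_lintegral_swap
    ((universallyMeasurable_killedValue y hf).aemeasurable _)]

theorem universallyMeasurable_lintegral_killedValue (m : Measure ℝ≥0) [SFinite m] (y : T)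
    {f : T → ℝ≥0∞} (hf : UniversallyMeasurable f) :
    UniversallyMeasurable fun w => ∫⁻ t, killedValue y f t w ∂m :=
  ((universallyMeasurable_killedValue y hf).comp measurable_swap).lintegral_prod m

theorem universallyMeasurable_lintegral_killedOccupation (m : Measure ℝ≥0) [SFinite m] (y : T)
    {f : T → ℝ≥0∞} (hf : UniversallyMeasurable f) :
    UniversallyMeasurable fun x => ∫⁻ z, f z ∂killedOccupation m P y x := by
  simp only [lintegral_killedOccupation' m y _ hf]
  exact (universallyMeasurable_lintegral_killedValue m y hf).lintegral_kernel P

theorem lintegral_aliveAt_mul (x y : T) (t : ℝ≥0) (F : RCPath T → ℝ≥0∞) :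
    ∫⁻ w, aliveAt t (hittingTime y w) * F w ∂(P x) =
      ∫⁻ w in {w | hittingTime y w ≤ t}ᶜ, F w ∂(P x) := by
  rw [← lintegral_indicator₀
    (nullMeasurableSet_of_augmented (isStopping_hittingTime (P x) y t)).compl]
  refine lintegral_congr fun w => ?_
  by_cases h : hittingTime y w ≤ t
  · simp [aliveAt, h]
  · simp [aliveAt, h, not_le.mp h]

/-- The Markov property at t, on the event of being alive at t, replaces a restart from `w t` by the
shifted path; then `killedValue_add` applies. -/
theorem IsStrongMarkovProcess.lintegral_killedValue_add (hP : IsStrongMarkovProcess P) (x y : T)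
    {f : T → ℝ≥0∞} (hf : UniversallyMeasurable f) (m : Measure ℝ≥0) [SFinite m] (t : ℝ≥0) :
    ∫⁻ w, killedValue y (fun z => ∫⁻ u, f u ∂killedOccupation m P y z) t w ∂(P x) =
      ∫⁻ s, ∫⁻ w, killedValue y f (t + s) w ∂(P x) ∂m := by
  have hA : MeasurableSet[augmented (P x) t] {w | hittingTime y w ≤ t}ᶜ :=
    @MeasurableSet.compl _ _ (augmented (P x) t) (isStopping_hittingTime (P x) y t)
  have hum : UniversallyMeasurable fun q : ℝ≥0 × RCPath T => killedValue y f (t + q.1) q.2 :=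
    (universallyMeasurable_killedValue y hf).comp
      (φ := fun q : ℝ≥0 × RCPath T => (t + q.1, q.2)) (by fun_prop)
  calc ∫⁻ w, killedValue y (fun z => ∫⁻ u, f u ∂killedOccupation m P y z) t w ∂(P x)
      = ∫⁻ w in {w | hittingTime y w ≤ t}ᶜ,
          ∫⁻ u, f u ∂killedOccupation m P y (w t) ∂(P x) := lintegral_aliveAt_mul x y t _
    _ = ∫⁻ w in {w | hittingTime y w ≤ t}ᶜ,
          ∫⁻ s, killedValue y f s (shift t w) ∂m ∂(P x) := by
        simp only [lintegral_killedOccupation' m y _ hf]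
        exact (hP.lintegral_shift x t hA
          (universallyMeasurable_lintegral_killedValue m y hf)).symm
    _ = ∫⁻ w, aliveAt t (hittingTime y w) * ∫⁻ s, killedValue y f s (shift t w) ∂m ∂(P x) :=
        (lintegral_aliveAt_mul x y t _).symm
    _ = ∫⁻ w, ∫⁻ s, killedValue y f (t + s) w ∂m ∂(P x) := by
        refine lintegral_congr fun w => ?_
        simp only [killedValue_add]
        exact (lintegral_const_mul' _ _ (by unfold aliveAt; split_ifs <;> simp)).symm
    _ = ∫⁻ s, ∫⁻ w, killedValue y f (t + s) w ∂(P x) ∂m :=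
        (lintegral_lintegral_swap (hum.aemeasurable _)).symm

/-- Composing occupation measures convolves the time measures. -/
theorem IsStrongMarkovProcess.lintegral_killedOccupation_conv (hP : IsStrongMarkovProcess P)
    (x y : T) {f : T → ℝ≥0∞} (hf : UniversallyMeasurable f) (m m' : Measure ℝ≥0) [SFinite m]
    [SFinite m'] :
    ∫⁻ z, ∫⁻ u, f u ∂killedOccupation m' P y z ∂killedOccupation m P y x =
      ∫⁻ u, f u ∂killedOccupation (m ∗ m') P y x := by
  rw [lintegral_killedOccupation m y x (universallyMeasurable_lintegral_killedOccupation m' y hf),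
    lintegral_killedOccupation (m ∗ m') y x hf]
  simp only [hP.lintegral_killedValue_add x y hf m']
  have hum : UniversallyMeasurable fun r => ∫⁻ w, killedValue y f r w ∂(P x) :=
    (universallyMeasurable_killedValue y hf).lintegral_prod (P x)
  rw [Measure.conv, lintegral_map' (hum.aemeasurable _) (by fun_prop), lintegral_prod _
    ((hum.comp measurable_add).aemeasurable _)]

end Killed

/-! ### Exponential time measures -/

/-- Lebesgue measure on `[0, ∞)`. -/
def timeMeasure : Measure ℝ≥0 := (volume.restrict (Ici (0 : ℝ))).map Real.toNNReal

instance : SFinite timeMeasure := by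
  unfold timeMeasure
  infer_instance

/-- The measure `exp (-a t) dt` on `[0, ∞)`. -/
def expTime (a : ℝ) : Measure ℝ≥0 :=
  timeMeasure.withDensity fun t => ENNReal.ofReal (Real.exp (-(a * t)))

instance (a : ℝ) : SFinite (expTime a) := by
  unfold expTime
  infer_instance

theorem measurable_ofReal_exp (a : ℝ) :
    Measurable fun t : ℝ≥0 => ENNReal.ofReal (Real.exp (-(a * t))) := by
  fun_prop

theorem lintegral_timeMeasure {H : ℝ≥0 → ℝ≥0∞} (hH : Measurable H) :
    ∫⁻ t, H t ∂timeMeasure = ∫⁻ t in Ici (0 : ℝ), H t.toNNReal :=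
  lintegral_map hH measurable_real_toNNReal

theorem lintegral_expTime (a : ℝ) {H : ℝ≥0 → ℝ≥0∞} (hH : Measurable H) :
    ∫⁻ t, H t ∂expTime a = ∫⁻ t, ENNReal.ofReal (Real.exp (-(a * t))) * H t ∂timeMeasure :=
  lintegral_withDensity_eq_lintegral_mul _ (measurable_ofReal_exp a) hH

theorem lintegral_timeMeasure_add (s : ℝ≥0) {H : ℝ≥0 → ℝ≥0∞} (hH : Measurable H) :
    ∫⁻ t, H (s + t) ∂timeMeasure = ∫⁻ t in Ici s, H t ∂timeMeasure := by
  rw [lintegral_timeMeasure (H := fun t => H (s + t)) (by fun_prop),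
    show ∫⁻ t in Ici s, H t ∂timeMeasure = ∫⁻ t, (Ici s).indicator H t ∂timeMeasure from
      (lintegral_indicator measurableSet_Ici _).symm,
    lintegral_timeMeasure (hH.indicator measurableSet_Ici), ← lintegral_indicator measurableSet_Ici,
    ← lintegral_indicator measurableSet_Ici,
    ← lintegral_add_left_eq_self (μ := (volume : Measure ℝ)) _ (-(s : ℝ))]
  refine lintegral_congr fun r => ?_
  simp only [indicator, mem_Ici]
  by_cases h : (s : ℝ) ≤ r
  · have h0 : 0 ≤ r := s.2.trans h
    rw [if_pos (by linarith), if_pos h0, if_pos (by rwa [Real.le_toNNReal_iff_coe_le h0])]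
    congr 1
    ext
    rw [NNReal.coe_add, Real.coe_toNNReal _ (by linarith), Real.coe_toNNReal _ h0]
    ring
  · rw [if_neg (by linarith)]
    by_cases h0 : 0 ≤ r
    · rw [if_pos h0, if_neg (by rwa [Real.le_toNNReal_iff_coe_le h0])]
    · rw [if_neg h0]

/-- Memorylessness of the exponential weight; with s the hitting time, it discounts the path after
that time. -/
theorem lintegral_expTime_Ici (a : ℝ) (s : ℝ≥0) {H : ℝ≥0 → ℝ≥0∞} (hH : Measurable H) :
    ∫⁻ t in Ici s, H t ∂expTime a =
      ENNReal.ofReal (Real.exp (-(a * s))) * ∫⁻ t, H (s + t) ∂expTime a := by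
  rw [lintegral_expTime a (by fun_prop), expTime, restrict_withDensity measurableSet_Ici,
    lintegral_withDensity_eq_lintegral_mul _ (measurable_ofReal_exp a) hH,
    ← lintegral_timeMeasure_add s ((measurable_ofReal_exp a).mul hH),
    ← lintegral_const_mul _ (by fun_prop)]
  refine lintegral_congr fun t => ?_
  rw [Pi.mul_apply, ← mul_assoc, ← ENNReal.ofReal_mul (Real.exp_pos _).le, ← Real.exp_add]
  congr 4
  push_cast
  ring

theorem expTime_Iic {a : ℝ} (ha : 0 < a) (r : ℝ≥0) :
    expTime a (Iic r) = ENNReal.ofReal ((1 - Real.exp (-(a * r))) / a) := by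
  rw [expTime, withDensity_apply _ measurableSet_Iic, ← lintegral_indicator measurableSet_Iic,
    lintegral_timeMeasure ((measurable_ofReal_exp a).indicator measurableSet_Iic)]
  have h1 : ∫⁻ t in Ici (0 : ℝ), (Iic r).indicator
      (fun t : ℝ≥0 => ENNReal.ofReal (Real.exp (-(a * t)))) t.toNNReal =
      ∫⁻ t in Icc (0 : ℝ) r, ENNReal.ofReal (Real.exp (-(a * t))) := by
    rw [← lintegral_indicator measurableSet_Ici, ← lintegral_indicator measurableSet_Icc]
    refine lintegral_congr fun t => ?_
    by_cases h0 : 0 ≤ t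
    · simp [indicator, h0, Real.toNNReal_le_iff_le_coe]
    · simp [indicator, h0]
  have hint : IntervalIntegrable (fun t => Real.exp (-(a * t))) volume 0 r :=
    (by fun_prop : Continuous fun t : ℝ => Real.exp (-(a * t))).intervalIntegrable _ _
  rw [h1, ← ofReal_integral_eq_lintegral_ofReal, integral_Icc_eq_integral_Ioc,
    ← intervalIntegral.integral_of_le r.coe_nonneg]
  · congr 1
    have hd : ∀ t ∈ uIcc (0 : ℝ) r,
        HasDerivAt (fun t => -(Real.exp (-(a * t)) / a)) (Real.exp (-(a * t))) t := fun t _ => by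
      have := ((((hasDerivAt_id t).const_mul a).neg).exp.div_const a).neg
      refine this.congr_deriv ?_
      simp only [id, mul_one, mul_neg, neg_div, neg_neg, Pi.neg_apply]
      rw [mul_div_cancel_right₀ _ ha.ne']
    rw [intervalIntegral.integral_eq_sub_of_hasDerivAt hd hint]
    simp
    ring
  · exact (by fun_prop : Continuous fun t : ℝ => Real.exp (-(a * t))).integrableOn_Icc
  · exact Eventually.of_forall fun t => (Real.exp_pos _).le

/-- Lebesgue measure as the solution of the renewal equation for exponential waiting times. -/
theorem timeMeasure_eq_expTime_add {a : ℝ} (ha : 0 < a) :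
    timeMeasure = expTime a + ENNReal.ofReal a • (expTime a ∗ timeMeasure) := by
  ext B hB
  have hm : Measurable (B.indicator (1 : ℝ≥0 → ℝ≥0∞)) := measurable_one.indicator hB
  -- By Tonelli the convolution has Lebesgue density (1 - exp (-a t)) / a, and exp (-a t) plus a
  -- times this is 1.
  have hconv : (expTime a ∗ timeMeasure) B =
      ∫⁻ t, B.indicator 1 t * expTime a (Iic t) ∂timeMeasure := by
    rw [← lintegral_indicator_one hB, Measure.lintegral_conv hm]
    simp only [lintegral_timeMeasure_add _ hm]
    have h1 : ∀ s : ℝ≥0, ∫⁻ t in Ici s, B.indicator 1 t ∂timeMeasure =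
        ∫⁻ t, (Ici s).indicator (1 : ℝ≥0 → ℝ≥0∞) t * B.indicator 1 t ∂timeMeasure := fun s => by
      rw [← lintegral_indicator measurableSet_Ici]
      refine lintegral_congr fun t => ?_
      by_cases h : t ∈ Ici s <;> simp [h]
    simp only [h1]
    have hm2 : Measurable fun p : ℝ≥0 × ℝ≥0 =>
        (Ici p.1).indicator (1 : ℝ≥0 → ℝ≥0∞) p.2 * B.indicator 1 p.2 := by
      refine Measurable.mul ?_ (hm.comp measurable_snd)
      exact (measurable_const (a := (1 : ℝ≥0∞))).indicator
        (measurableSet_le measurable_fst measurable_snd)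
    rw [lintegral_lintegral_swap hm2.aemeasurable]
    refine lintegral_congr fun t => ?_
    have h2 : ∀ s, (Ici s).indicator (1 : ℝ≥0 → ℝ≥0∞) t * B.indicator 1 t =
        B.indicator 1 t * (Iic t).indicator 1 s := fun s => by
      rw [mul_comm]
      rfl
    simp only [h2]
    rw [lintegral_const_mul _ (measurable_one.indicator measurableSet_Iic),
      lintegral_indicator_one measurableSet_Iic]
  have hexp : Measurable fun t => expTime a (Iic t) := by
    simp only [expTime_Iic ha]
    fun_prop
  rw [Measure.add_apply, Measure.smul_apply, hconv, expTime, withDensity_apply _ hB, ← expTime,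
    ← lintegral_indicator hB, smul_eq_mul, ← lintegral_const_mul _
      (show Measurable fun t => B.indicator 1 t * expTime a (Iic t) from hm.mul hexp),
    ← lintegral_add_left ((measurable_ofReal_exp a).indicator hB), ← lintegral_indicator_one hB]
  refine lintegral_congr fun t => ?_
  by_cases h : t ∈ B
  · have hle : Real.exp (-(a * t)) ≤ 1 := Real.exp_le_one_iff.mpr (by
      have := mul_nonneg ha.le t.2
      simpa using this)
    simp only [h, indicator_of_mem, Pi.one_apply, one_mul, expTime_Iic ha]
    rw [← ENNReal.ofReal_mul ha.le, ← ENNReal.ofReal_add (Real.exp_pos _).le (by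
      have : 0 ≤ 1 - Real.exp (-(a * t)) := by linarith
      positivity), mul_div_cancel₀ _ ha.ne']
    simp
  · simp [h]

/-! ### The potential determines the resolvent of the killed process -/

section Resolvent

variable {T : Type*} [MetricSpace T] [CompactSpace T] [MeasurableSpace T] [BorelSpace T]
  {P Q : Kernel T (RCPath T)}

open RCPath

theorem expectedOccupation_eq [IsMarkovKernel P] (x y : T) {f : T → ℝ≥0} (hf : Measurable f) :
    expectedOccupation P x y f = ∫⁻ z, f z ∂killedOccupation timeMeasure P y x := by
  rw [lintegral_killedOccupation' _ _ _ (.of_measurable hf.coe_nnreal_ennreal), expectedOccupation]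
  refine lintegral_congr fun w => ?_
  have hw : Measurable w.1 := measurable_uncurry_eval.comp (measurable_prodMk_right (y := w))
  have hm : Measurable fun t : ℝ≥0 => killedValue y (fun z => (f z : ℝ≥0∞)) t w :=
    (measurable_aliveAt.comp (measurable_coe_nnreal_ennreal.prodMk measurable_const)).mul
      (hf.comp hw).coe_nnreal_ennreal
  have hS : MeasurableSet {t : ℝ | 0 ≤ t ∧ ENNReal.ofReal t < hittingTime y w} :=
    (measurableSet_le measurable_const measurable_id).inter
      (measurableSet_lt ENNReal.measurable_ofReal measurable_const)
  rw [lintegral_timeMeasure hm, ← lintegral_indicator hS, ← lintegral_indicator measurableSet_Ici]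
  refine lintegral_congr fun t => ?_
  simp only [indicator, mem_ofPred_eq, mem_Ici, killedValue, aliveAt, ENNReal.ofReal]
  by_cases h0 : 0 ≤ t <;> by_cases h1 : (t.toNNReal : ℝ≥0∞) < hittingTime y w <;> simp [h0, h1]

theorem killedOccupation_timeMeasure_congr [IsMarkovKernel P] [IsMarkovKernel Q] {x y : T}
    (hocc : ∀ f : T → ℝ≥0, Measurable f → (∃ C : ℝ≥0, ∀ z, f z ≤ C) →
      expectedOccupation P x y f = expectedOccupation Q x y f) :
    killedOccupation timeMeasure P y x = killedOccupation timeMeasure Q y x := by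
  ext B hB
  have hm : Measurable (B.indicator (1 : T → ℝ≥0)) := measurable_one.indicator hB
  have h := hocc (B.indicator 1) hm ⟨1, fun z => by
    by_cases hz : z ∈ B <;> simp [hz]⟩
  rw [expectedOccupation_eq x y hm, expectedOccupation_eq x y hm] at h
  rw [← lintegral_indicator_one hB, ← lintegral_indicator_one hB]
  convert h using 3 <;> simp [indicator, apply_ite]

/-- The resolvent equation, inherited from the decomposition of Lebesgue time. Keeping the
convolution leaves both orders of composition, U_a U and U U_a, available. -/
theorem IsStrongMarkovProcess.lintegral_resolvent (hP : IsStrongMarkovProcess P) {a : ℝ}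
    (ha : 0 < a) (x y : T) {f : T → ℝ≥0∞} (hf : UniversallyMeasurable f) :
    ∫⁻ z, f z ∂killedOccupation timeMeasure P y x =
      ∫⁻ z, f z ∂killedOccupation (expTime a) P y x + ENNReal.ofReal a *
        ∫⁻ z, f z ∂killedOccupation (expTime a ∗ timeMeasure) P y x := by
  have := hP.isMarkovKernel
  rw [lintegral_killedOccupation _ y x hf, lintegral_killedOccupation (expTime a) y x hf,
    lintegral_killedOccupation (expTime a ∗ timeMeasure) y x hf]
  conv_lhs => rw [timeMeasure_eq_expTime_add ha]
  rw [lintegral_add_measure, lintegral_smul_measure, smul_eq_mul]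

/-- With V_P and V_Q the two resolvents, U the common potential and W = V_Q f, the equation for Q
reads Uf = W + a UW. Applying V_P and then the equation of P for W gives V_P Uf = V_P W + a V_P UW =
UW. So the equation of P for f reads Uf = V_P f + a UW, and the finite term a UW cancels. -/
theorem lintegral_killedOccupation_expTime_eq (hP : IsStrongMarkovProcess P)
    (hQ : IsStrongMarkovProcess Q) {y : T}
    (h : ∀ x, killedOccupation timeMeasure P y x = killedOccupation timeMeasure Q y x)
    {a : ℝ} (ha : 0 < a) (x : T) {f : T → ℝ≥0∞} (hf : UniversallyMeasurable f)
    (hfin : ∫⁻ z, f z ∂killedOccupation timeMeasure P y x ≠ ∞) :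
    ∫⁻ z, f z ∂killedOccupation (expTime a) P y x =
      ∫⁻ z, f z ∂killedOccupation (expTime a) Q y x := by
  have := hP.isMarkovKernel
  have := hQ.isMarkovKernel
  set W : T → ℝ≥0∞ := fun x => ∫⁻ z, f z ∂killedOccupation (expTime a) Q y x with hW
  have hWm : UniversallyMeasurable W := universallyMeasurable_lintegral_killedOccupation _ y hf
  have hGW : UniversallyMeasurable fun x => ∫⁻ z, W z ∂killedOccupation timeMeasure P y x :=
    universallyMeasurable_lintegral_killedOccupation _ y hWm
  have eQ : ∀ x, ∫⁻ z, f z ∂killedOccupation timeMeasure P y x =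
      W x + ENNReal.ofReal a * ∫⁻ z, W z ∂killedOccupation timeMeasure P y x := fun x => by
    rw [h x, hQ.lintegral_resolvent ha x y hf, Measure.conv_comm,
      ← hQ.lintegral_killedOccupation_conv x y hf]
  have eP : ∫⁻ z, f z ∂killedOccupation (expTime a ∗ timeMeasure) P y x =
      ∫⁻ z, W z ∂killedOccupation timeMeasure P y x := by
    rw [← hP.lintegral_killedOccupation_conv x y hf, hP.lintegral_resolvent ha x y hWm,
      ← hP.lintegral_killedOccupation_conv x y hWm]
    simp only [eQ]
    rw [lintegral_add_left' (hWm.aemeasurable _), lintegral_const_mul' _ _ ENNReal.ofReal_ne_top]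
  have e1 := hP.lintegral_resolvent ha x y hf
  rw [eP] at e1
  have e2 := eQ x
  have hc : ENNReal.ofReal a * ∫⁻ z, W z ∂killedOccupation timeMeasure P y x ≠ ∞ :=
    ne_top_of_le_ne_top hfin (e1 ▸ le_add_self)
  exact (ENNReal.add_left_inj hc).mp (e1.symm.trans e2)

/-- A transient potential kernel determines its resolvent. -/
theorem killedOccupation_expTime_congr (hP : IsStrongMarkovProcess P)
    (hQ : IsStrongMarkovProcess Q) {y : T}
    (h : ∀ x, killedOccupation timeMeasure P y x = killedOccupation timeMeasure Q y x)
    (htrans : IsTransientUntilHitting P y) {a : ℝ} (ha : 0 < a) (x : T) :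
    killedOccupation (expTime a) P y x = killedOccupation (expTime a) Q y x := by
  have := hP.isMarkovKernel
  have := hQ.isMarkovKernel
  obtain ⟨g, hg, hpos, hfin⟩ := htrans
  have hgm : Measurable fun z => (g z : ℝ≥0∞) := hg.coe_nnreal_ennreal
  -- Weighting by g makes the potential of every indicator finite; since g is positive and finite,
  -- the weight can be divided out afterwards.
  have key : (killedOccupation (expTime a) P y x).withDensity (fun z => (g z : ℝ≥0∞)) =
      (killedOccupation (expTime a) Q y x).withDensity (fun z => (g z : ℝ≥0∞)) := by
    ext B hB
    rw [withDensity_apply _ hB, withDensity_apply _ hB, ← lintegral_indicator hB,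
      ← lintegral_indicator hB]
    refine lintegral_killedOccupation_expTime_eq hP hQ h ha x
      (.of_measurable (hgm.indicator hB)) ?_
    have hx := hfin x
    rw [expectedOccupation_eq x y hg] at hx
    exact (lt_of_le_of_lt (lintegral_mono fun z => indicator_le_self _ _ z) hx).ne
  have inv : ∀ μ : Measure T, (μ.withDensity fun z => (g z : ℝ≥0∞)).withDensity
      (fun z => (g z : ℝ≥0∞)⁻¹) = μ := fun μ =>
    withDensity_inv_same hgm (Eventually.of_forall fun z => by simpa using (hpos z).ne')
      (Eventually.of_forall fun z => ENNReal.coe_ne_top)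
  rw [← inv (killedOccupation (expTime a) P y x), key, inv]

end Resolvent

/-! ### Uniqueness of Laplace transforms -/

open scoped BoundedContinuousFunction

/-- A finite measure on `[0, ∞)` is determined by its Laplace transform at the integers. -/
theorem MeasureTheory.Measure.ext_of_lintegral_exp_neg {μ ν : Measure ℝ≥0} [IsFiniteMeasure μ]
    [IsFiniteMeasure ν] (h : ∀ n : ℕ, ∫⁻ t : ℝ≥0, ENNReal.ofReal (Real.exp (-(n * t))) ∂μ =
      ∫⁻ t : ℝ≥0, ENNReal.ofReal (Real.exp (-(n * t))) ∂ν) : μ = ν := by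
  let e : ℝ≥0 →ᵇ ℝ := BoundedContinuousFunction.ofNormedAddCommGroup
    (fun t : ℝ≥0 => Real.exp (-t)) (by fun_prop) 1 fun t => by
      rw [Real.norm_of_nonneg (Real.exp_pos _).le, Real.exp_le_one_iff]
      exact neg_nonpos.mpr t.2
  have he : ∀ t, e t = Real.exp (-t) := fun t => rfl
  have hstar : ∀ g : ℝ≥0 →ᵇ ℝ, star g = g := fun g => by
    ext
    simp
  -- The polynomials in exp (-t): they separate points and are spanned by the functions exp (-n t),
  -- whose integrals are given.
  let A : StarSubalgebra ℝ (ℝ≥0 →ᵇ ℝ) :=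
    { Algebra.adjoin ℝ {e} with star_mem' := fun {g} hg => (hstar g).symm ▸ hg }
  refine ext_of_forall_mem_subalgebra_integral_eq_of_polish (𝕜 := ℝ) (A := A) ?_ ?_
  · intro s t hst
    refine ⟨e, ⟨e.toContinuousMap, ⟨e, Algebra.self_mem_adjoin_singleton ℝ e, rfl⟩, rfl⟩, ?_⟩
    rw [he, he]
    intro h'
    exact hst (NNReal.coe_injective (neg_injective (Real.exp_injective h')))
  · intro g hg
    have hg' : g ∈ Submodule.span ℝ (Submonoid.closure {e} : Set (ℝ≥0 →ᵇ ℝ)) := by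
      rw [← Algebra.adjoin_eq_span]
      exact hg
    clear hg
    induction hg' using Submodule.span_induction with
    | mem g hg =>
      obtain ⟨n, rfl⟩ := Submonoid.mem_closure_singleton.mp hg
      have hpow : ∀ t, (e ^ n) t = Real.exp (-(n * t)) := fun t => by
        rw [BoundedContinuousFunction.coe_pow, Pi.pow_apply, he, ← Real.exp_nat_mul]
        congr 1
        ring
      simp only [hpow]
      rw [integral_eq_lintegral_of_nonneg_ae (Eventually.of_forall fun t => (Real.exp_pos _).le)
        (by fun_prop), integral_eq_lintegral_of_nonneg_ae
        (Eventually.of_forall fun t => (Real.exp_pos _).le) (by fun_prop), h n]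
    | zero => simp
    | add f g hf hg ihf ihg =>
      simp only [BoundedContinuousFunction.coe_add, Pi.add_apply]
      have hint : ∀ (ρ : Measure ℝ≥0) [IsFiniteMeasure ρ] (f : ℝ≥0 →ᵇ ℝ), Integrable f ρ :=
        fun ρ _ f => f.integrable ρ
      rw [integral_add (hint μ f) (hint μ g), integral_add (hint ν f) (hint ν g), ihf, ihg]
    | smul c g hg ih =>
      simp only [BoundedContinuousFunction.coe_smul]
      rw [integral_smul, integral_smul, ih]

theorem isFiniteMeasure_expTime {a : ℝ} (ha : 0 < a) : IsFiniteMeasure (expTime a) := by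
  refine ⟨lt_of_le_of_lt (le_of_tendsto' (tendsto_measure_Iic_atTop (expTime a)) fun r => ?_)
    (ENNReal.ofReal_lt_top (r := 1 / a))⟩
  rw [expTime_Iic ha]
  gcongr
  linarith [Real.exp_pos (-(a * r))]

theorem expTime_Ioc_ne_zero {a : ℝ} (ha : 0 < a) {s t : ℝ≥0} (hst : s < t) :
    expTime a (Ioc s t) ≠ 0 := by
  intro h0
  have hle : expTime a (Iic t) ≤ expTime a (Iic s) := by
    rw [← Iic_union_Ioc_eq_Iic hst.le]
    exact (measure_union_le _ _).trans (by simp [h0])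
  rw [expTime_Iic ha, expTime_Iic ha] at hle
  have hlt : Real.exp (-(a * t)) < Real.exp (-(a * s)) := by
    have : (s : ℝ) < t := hst
    gcongr
  refine hle.not_gt (ENNReal.ofReal_lt_ofReal_iff_of_nonneg ?_ |>.mpr (by gcongr))
  refine div_nonneg ?_ ha.le
  have : Real.exp (-(a * s)) ≤ 1 := Real.exp_le_one_iff.mpr
    (neg_nonpos.mpr (mul_nonneg ha.le s.2))
  linarith

/-- Bounded right-continuous functions on `[0, ∞)` agree if their Laplace transforms agree. -/
theorem eq_of_lintegral_expTime_eq {u v : ℝ≥0 → ℝ≥0∞} (hu : Measurable u) (hv : Measurable v)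
    {C : ℝ≥0∞} (hC : C ≠ ∞) (huC : ∀ t, u t ≤ C) (hvC : ∀ t, v t ≤ C)
    (huc : ∀ t, ContinuousWithinAt u (Ici t) t) (hvc : ∀ t, ContinuousWithinAt v (Ici t) t)
    (h : ∀ a : ℝ, 0 < a → ∫⁻ t, u t ∂expTime a = ∫⁻ t, v t ∂expTime a) : u = v := by
  have := isFiniteMeasure_expTime one_pos
  have hfin : ∀ {f : ℝ≥0 → ℝ≥0∞}, (∀ t, f t ≤ C) → ∫⁻ t, f t ∂expTime 1 ≠ ∞ := fun hf =>
    ((lintegral_mono hf).trans_lt (by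
      rw [lintegral_const]
      exact ENNReal.mul_lt_top hC.lt_top (measure_lt_top _ _))).ne
  have := isFiniteMeasure_withDensity (hfin huC)
  have := isFiniteMeasure_withDensity (hfin hvC)
  -- The base weight exp (-t) makes the measures finite and shifts the Laplace argument from n to n
  -- + 1, which is positive even for n = 0.
  have hexp : ∀ {f : ℝ≥0 → ℝ≥0∞}, Measurable f → ∀ n : ℕ,
      ∫⁻ t : ℝ≥0, ENNReal.ofReal (Real.exp (-(n * t))) ∂(expTime 1).withDensity f =
        ∫⁻ t, f t ∂expTime (n + 1) := fun {f} hf n => by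
    have hm := measurable_ofReal_exp n
    rw [lintegral_withDensity_eq_lintegral_mul _ hf hm, lintegral_expTime _ (hf.mul hm),
      lintegral_expTime _ hf]
    refine lintegral_congr fun t => ?_
    rw [Pi.mul_apply, mul_comm (f t), ← mul_assoc, ← ENNReal.ofReal_mul (Real.exp_pos _).le,
      ← Real.exp_add]
    congr 4
    ring
  have hdens : (expTime 1).withDensity u = (expTime 1).withDensity v :=
    Measure.ext_of_lintegral_exp_neg fun n => by
      rw [hexp hu, hexp hv, h _ (by positivity)]
  have hae : u =ᵐ[expTime 1] v :=
    (withDensity_eq_iff hu.aemeasurable hv.aemeasurable (hfin huC)).mp hdens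
  funext t
  -- Intervals to the right of t have positive measure, so points of the almost everywhere equality
  -- accumulate at t from the right.
  have hex : ∀ n : ℕ, ∃ s ∈ Ioc t (t + 1 / (n + 1)), u s = v s := fun n => by
    by_contra! hne
    refine expTime_Ioc_ne_zero one_pos (lt_add_of_pos_right t (by positivity : (0 : ℝ≥0) <
      1 / (n + 1))) (measure_mono_null (fun s hs => ?_) hae)
    exact hne s hs
  choose s hs hsuv using hex
  have hlim : Tendsto s atTop (𝓝[Ici t] t) := by
    refine tendsto_nhdsWithin_iff.mpr ⟨?_, Eventually.of_forall fun n => (hs n).1.le⟩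
    refine tendsto_of_tendsto_of_tendsto_of_le_of_le tendsto_const_nhds ?_
      (fun n => (hs n).1.le) (fun n => (hs n).2)
    have : Tendsto (fun n : ℕ => (1 : ℝ≥0) / (n + 1)) atTop (𝓝 0) :=
      tendsto_one_div_add_atTop_nhds_zero_nat
    simpa using this.const_add t
  refine tendsto_nhds_unique ((huc t).tendsto.comp hlim) ?_
  exact ((hvc t).tendsto.comp hlim).congr fun n => (hsuv n).symm

/-- An affine map of slope below 1 has one finite fixed point; finiteness is assumed because ∞ may
be another. -/
theorem ENNReal.eq_of_eq_add_mul {A k r s : ℝ≥0∞} (hk : k < 1) (hr : r ≠ ∞) (hs : s ≠ ∞)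
    (h1 : r = A + k * r) (h2 : s = A + k * s) : r = s := by
  have hA : A ≠ ∞ := ne_top_of_le_ne_top hr (h1 ▸ le_self_add)
  lift r to ℝ≥0 using hr
  lift s to ℝ≥0 using hs
  lift A to ℝ≥0 using hA
  lift k to ℝ≥0 using (hk.trans ENNReal.one_lt_top).ne
  have hk' : (k : ℝ) < 1 := by exact_mod_cast hk
  have h1' : (r : ℝ) = A + k * r := by exact_mod_cast h1
  have h2' : (s : ℝ) = A + k * s := by exact_mod_cast h2
  have h3 : ((r : ℝ) - s) * (1 - k) = 0 := by linear_combination h1' - h2'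
  rcases mul_eq_zero.mp h3 with h4 | h4
  · exact_mod_cast sub_eq_zero.mp h4
  · linarith

/-! ### From resolvents to the law on path space -/

section Laplace

variable {T : Type*} [MetricSpace T] [MeasurableSpace T] {P Q : Kernel T (RCPath T)}

open RCPath

/-- The Laplace transform of the hitting time of `y` for the process started in `x`. -/
def hittingLaplace (a : ℝ) (P : Kernel T (RCPath T)) (x y : T) : ℝ≥0∞ :=
  ∫⁻ w in {w | hittingTime y w < ∞},
    ENNReal.ofReal (Real.exp (-(a * (hittingTime y w).toNNReal))) ∂(P x)

/-- The resolvent of the process: the expected value of `f` along the path, integrated against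
exponentially decaying weights. -/
def markovResolvent (a : ℝ) (P : Kernel T (RCPath T)) (f : T → ℝ≥0∞) (x : T) : ℝ≥0∞ :=
  ∫⁻ w, ∫⁻ t, f (w t) ∂expTime a ∂(P x)

theorem hittingLaplace_le_one [IsMarkovKernel P] {a : ℝ} (ha : 0 < a) (x y : T) :
    hittingLaplace a P x y ≤ 1 := by
  have h : hittingLaplace a P x y ≤ ∫⁻ _ in {w | hittingTime y w < ∞}, 1 ∂(P x) :=
    lintegral_mono fun w => ENNReal.ofReal_le_one.mpr (Real.exp_le_one_iff.mpr
      (neg_nonpos.mpr (mul_nonneg ha.le (NNReal.coe_nonneg _))))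
  refine h.trans ?_
  rw [setLIntegral_one]
  exact prob_le_one

theorem markovResolvent_const [IsMarkovKernel P] (a : ℝ) (c : ℝ≥0∞) (x : T) :
    markovResolvent a P (fun _ => c) x = c * expTime a univ := by
  simp [markovResolvent]

variable [BorelSpace T]

/-- Splitting a path at the hitting time of `y`. -/
theorem lintegral_expTime_eq_killedValue_add (a : ℝ) (y : T) {f : T → ℝ≥0∞} (hf : Measurable f)
    (w : RCPath T) :
    ∫⁻ t, f (w t) ∂expTime a = ∫⁻ t, killedValue y f t w ∂expTime a +
      {w | hittingTime y w < ∞}.indicator (fun w =>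
        ENNReal.ofReal (Real.exp (-(a * (hittingTime y w).toNNReal))) *
          ∫⁻ t, f (shift (hittingTime y w).toNNReal w t) ∂expTime a) w := by
  have hw : Measurable w.1 := measurable_uncurry_eval.comp (measurable_prodMk_right (y := w))
  by_cases hfin : hittingTime y w < ∞
  · have hmem : w ∈ {w | hittingTime y w < ∞} := hfin
    rw [indicator_of_mem hmem]
    set σ := (hittingTime y w).toNNReal with hσ
    have hσ' : (σ : ℝ≥0∞) = hittingTime y w := ENNReal.coe_toNNReal hfin.ne
    have h1 : ∫⁻ t, killedValue y f t w ∂expTime a = ∫⁻ t in (Ici σ)ᶜ, f (w t) ∂expTime a := by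
      rw [← lintegral_indicator measurableSet_Ici.compl]
      refine lintegral_congr fun t => ?_
      rw [killedValue, aliveAt, ← hσ']
      by_cases ht : t < σ
      · simp [ht]
      · simp [ht]
    have h2 := lintegral_expTime_Ici a σ (hf.comp hw)
    rw [h1, add_comm, ← lintegral_add_compl _ (measurableSet_Ici (a := σ))]
    congr 1
  · have hmem : w ∉ {w | hittingTime y w < ∞} := hfin
    rw [indicator_of_notMem hmem, add_zero]
    refine lintegral_congr fun t => ?_
    rw [killedValue, aliveAt, not_lt_top_iff.mp hfin, if_pos ENNReal.coe_lt_top, one_mul]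

theorem measurable_lintegral_expTime (a : ℝ) {f : T → ℝ≥0∞} (hf : Measurable f) :
    Measurable fun w : RCPath T => ∫⁻ t, f (w t) ∂expTime a :=
  ((hf.comp measurable_uncurry_eval).comp measurable_swap).lintegral_prod_right'

/-- Equal resolvents imply equal one-dimensional distributions. -/
theorem map_eval_congr [IsMarkovKernel P] [IsMarkovKernel Q] {x : T}
    (h : ∀ a : ℝ, 0 < a → ∀ f : T →ᵇ ℝ≥0,
      markovResolvent a P (fun z => f z) x = markovResolvent a Q (fun z => f z) x) (t : ℝ≥0) :
    (P x).map (fun w => w t) = (Q x).map fun w => w t := by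
  refine ext_of_forall_lintegral_eq_of_IsFiniteMeasure fun f => ?_
  obtain ⟨C, hC⟩ : ∃ C : ℝ≥0, ∀ z, f z ≤ C :=
    ⟨nndist f 0, fun z => by
      simpa using BoundedContinuousFunction.nndist_coe_le_nndist (f := f) (g := 0) z⟩
  have hfm : Measurable fun z => (f z : ℝ≥0∞) := f.continuous.measurable.coe_nnreal_ennreal
  have hm : ∀ (R : Kernel T (RCPath T)) [IsMarkovKernel R],
      Measurable fun t => ∫⁻ w, (f (w t) : ℝ≥0∞) ∂(R x) := fun R _ =>
    (hfm.comp measurable_uncurry_eval).lintegral_prod_right'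
  have hb : ∀ (R : Kernel T (RCPath T)) [IsMarkovKernel R] (t : ℝ≥0),
      ∫⁻ w, (f (w t) : ℝ≥0∞) ∂(R x) ≤ C := fun R _ t => by
    refine (lintegral_mono fun (w : RCPath T) => ENNReal.coe_le_coe.mpr (hC (w t))).trans ?_
    simp
  have hc : ∀ (R : Kernel T (RCPath T)) [IsMarkovKernel R] (t : ℝ≥0),
      ContinuousWithinAt (fun t => ∫⁻ w, (f (w t) : ℝ≥0∞) ∂(R x)) (Ici t) t := fun R _ t =>
    tendsto_lintegral_filter_of_dominated_convergence (fun _ => (C : ℝ≥0∞))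
      (Eventually.of_forall fun s => hfm.comp (measurable_eval s))
      (Eventually.of_forall fun s => Eventually.of_forall fun w => ENNReal.coe_le_coe.mpr (hC _))
      (by simp)
      (Eventually.of_forall fun w => ENNReal.tendsto_coe.mpr
        ((f.continuous.tendsto _).comp (w.2 t)))
  have hswap : ∀ (R : Kernel T (RCPath T)) [IsMarkovKernel R] (a : ℝ),
      markovResolvent a R (fun z => f z) x = ∫⁻ t, ∫⁻ w, (f (w t) : ℝ≥0∞) ∂(R x) ∂expTime a :=
    fun R _ a => lintegral_lintegral_swap
      ((hfm.comp measurable_uncurry_eval).comp measurable_swap).aemeasurable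
  rw [lintegral_map hfm (measurable_eval t), lintegral_map hfm (measurable_eval t)]
  refine congrFun (eq_of_lintegral_expTime_eq (hm P) (hm Q) ENNReal.coe_ne_top (hb P) (hb Q)
    (hc P) (hc Q) fun a ha => ?_) t
  rw [← hswap P a, ← hswap Q a, h a ha f]

theorem IsStrongMarkovProcess.measure_eval_inter_shift (hP : IsStrongMarkovProcess P) (x : T)
    (t : ℝ≥0) {A : Set T} (hA : MeasurableSet A) {B : Set (RCPath T)} (hB : MeasurableSet B) :
    P x {w | w t ∈ A ∧ shift t w ∈ B} = ∫⁻ z in A, P z B ∂(P x).map fun w => w t := by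
  have := hP.isMarkovKernel
  have hE : MeasurableSet[augmented (P x) t] {w : RCPath T | w t ∈ A} := by
    refine le_eventuallyMeasurableSpace _ ?_
    rw [MeasurableSpace.measurableSet_iInf]
    intro s
    rw [MeasurableSpace.measurableSet_iInf]
    intro hs
    exact measurable_eval_past hs.le hA
  have h := congrArg (fun ρ : Measure (RCPath T) => ρ B) (hP.map_shift x t hE)
  have hm : MeasurableSet {w : RCPath T | w t ∈ A} := measurable_eval t hA
  simp only [Measure.map_apply (measurable_shift t) hB, Measure.bind_apply hB P.aemeasurable,
    Measure.restrict_apply (measurable_shift t hB)] at h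
  rw [Measure.restrict_map (measurable_eval t) hA]
  refine Eq.trans ?_ h
  rw [inter_comm]
  rfl

/-- A strong Markov process is determined by its one-dimensional distributions. -/
theorem IsStrongMarkovProcess.ext_of_map_eval (hP : IsStrongMarkovProcess P)
    (hQ : IsStrongMarkovProcess Q)
    (h : ∀ (x : T) (t : ℝ≥0), (P x).map (fun w => w t) = (Q x).map fun w => w t) (x : T) :
    P x = Q x := by
  have := hP.isMarkovKernel
  have := hQ.isMarkovKernel
  -- Times are measured from a moving origin s: after the Markov property at the earliest time b,
  -- the remaining event has the same form with origin b. The start must stay arbitrary for the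
  -- restart.
  have key : ∀ (A : ℝ≥0 → Set T), (∀ t, MeasurableSet (A t)) → ∀ (I : Finset ℝ≥0) (s : ℝ≥0),
      (∀ t ∈ I, s ≤ t) → ∀ x, P x {w | ∀ t ∈ I, w (t - s) ∈ A t} =
        Q x {w | ∀ t ∈ I, w (t - s) ∈ A t} := by
    intro A hA I
    induction I using Finset.induction_on_min with
    | empty => simp
    | insert b J hb ih =>
      intro s hs x
      have hsb : s ≤ b := hs b (Finset.mem_insert_self _ _)
      have hset : {w : RCPath T | ∀ t ∈ insert b J, w (t - s) ∈ A t} =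
          {w | w (b - s) ∈ A b ∧ shift (b - s) w ∈ {w | ∀ t ∈ J, w (t - b) ∈ A t}} := by
        ext w
        have hJ : ∀ t ∈ J, w (t - s) = shift (b - s) w (t - b) := fun t ht => by
          change w (t - s) = w (b - s + (t - b))
          rw [add_comm, tsub_add_tsub_cancel (hb t ht).le hsb]
        simp only [Finset.forall_mem_insert, mem_ofPred_eq]
        exact and_congr_right fun _ => forall₂_congr fun t ht => by rw [hJ t ht]
      have hB : MeasurableSet {w : RCPath T | ∀ t ∈ J, w (t - b) ∈ A t} := by
        have : {w : RCPath T | ∀ t ∈ J, w (t - b) ∈ A t} =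
            ⋂ t ∈ J, {w : RCPath T | w (t - b) ∈ A t} := by
          ext w
          simp
        rw [this]
        exact Finset.measurableSet_biInter _ fun t _ => measurable_eval _ (hA t)
      rw [hset, hP.measure_eval_inter_shift x _ (hA b) hB,
        hQ.measure_eval_inter_shift x _ (hA b) hB, h]
      exact lintegral_congr fun z => ih b (fun t ht => (hb t ht).le) z
  have hgen : (instMeasurableSpace : MeasurableSpace (RCPath T)) =
      MeasurableSpace.generateFrom (piiUnionInter (fun t : ℝ≥0 =>
        {S | MeasurableSet[MeasurableSpace.comap (fun w : RCPath T => w t) inferInstance] S})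
        univ) := by
    refine Eq.trans ?_ (generateFrom_piiUnionInter_measurableSet (fun t : ℝ≥0 =>
      MeasurableSpace.comap (fun w : RCPath T => w t) inferInstance) univ).symm
    simp only [mem_univ, iSup_pos]
    rfl
  refine ext_of_generate_finite _ hgen (isPiSystem_piiUnionInter _ (fun t =>
    @MeasurableSpace.isPiSystem_measurableSet _ (MeasurableSpace.comap _ _)) _) ?_ (by simp)
  rintro _ ⟨I, -, S, hS, rfl⟩
  choose! A hA hAS using hS
  have hset : ⋂ t ∈ I, S t = {w : RCPath T | ∀ t ∈ I, w (t - 0) ∈ if t ∈ I then A t else univ} := by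
    ext w
    simp only [mem_iInter, mem_ofPred_eq, tsub_zero]
    exact forall₂_congr fun t ht => by rw [← hAS t ht, if_pos ht]; rfl
  rw [hset]
  refine key (fun t => if t ∈ I then A t else univ) (fun t => ?_) I 0 (fun _ _ => zero_le) x
  split_ifs with ht
  · exact hA t ht
  · exact MeasurableSet.univ

end Laplace

/-! ### Decomposition at the hitting time -/

section StrongMarkov

variable {T : Type*} [MetricSpace T] [CompactSpace T] [MeasurableSpace T] [BorelSpace T]
  {P Q : Kernel T (RCPath T)}

open RCPath

theorem aemeasurable_shift_hittingTime (μ : Measure (RCPath T)) [IsFiniteMeasure μ] (y : T) :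
    AEMeasurable (fun w => shift (hittingTime y w).toNNReal w) μ :=
  measurable_uncurry_shift.comp_aemeasurable
    ((aemeasurable_hittingTime μ y).ennreal_toNNReal.prodMk aemeasurable_id)

theorem nullMeasurableSet_hittingTime_lt_top (μ : Measure (RCPath T)) [IsFiniteMeasure μ]
    (y : T) : NullMeasurableSet {w | hittingTime y w < ∞} μ :=
  (aemeasurable_hittingTime μ y).nullMeasurable measurableSet_Iio

/-- The path sits at `y` at its hitting time, so the restarted law is the constant `P y`, which
factors out of the strong Markov identity. -/
theorem IsStrongMarkovProcess.measure_hittingTime_le (hP : IsStrongMarkovProcess P) (x y : T)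
    (s : ℝ≥0) {B : Set (RCPath T)} (hB : MeasurableSet B) :
    P x {w | hittingTime y w ≤ s ∧ shift (hittingTime y w).toNNReal w ∈ B} =
      P x {w | hittingTime y w ≤ s} * P y B := by
  have := hP.isMarkovKernel
  have hpast : InPastOf (P x) (hittingTime y) {w | hittingTime y w ≤ s} := by
    intro t
    have : {w | hittingTime y w ≤ s} ∩ {w | hittingTime y w ≤ t} =
        {w | hittingTime y w ≤ (min s t : ℝ≥0)} := by
      ext w
      simp [ENNReal.coe_min]
    rw [this]
    exact augmented_mono _ (min_le_right s t) _ (isStopping_hittingTime (P x) y _)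
  have h := hP.strongMarkov x _ (isStopping_hittingTime (P x) y) _ hpast B hB
  have hset : {w | hittingTime y w ≤ s} ∩ {w | hittingTime y w < ∞} =
      {w | hittingTime y w ≤ s} :=
    inter_eq_left.mpr fun w hw => lt_of_le_of_lt hw ENNReal.coe_lt_top
  rw [hset] at h
  have hn : NullMeasurableSet {w | hittingTime y w ≤ s} (P x) :=
    nullMeasurableSet_of_augmented (isStopping_hittingTime (P x) y s)
  have hconst : ∫⁻ w in {w | hittingTime y w ≤ s}, P (w (hittingTime y w).toNNReal) B ∂(P x) =
      ∫⁻ w in {w | hittingTime y w ≤ s}, P y B ∂(P x) := by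
    refine lintegral_congr_ae ?_
    filter_upwards [ae_restrict_mem₀ hn] with w hw
    rw [apply_hittingTime (lt_of_le_of_lt hw ENNReal.coe_lt_top)]
  rw [hconst, setLIntegral_const, mul_comm] at h
  rw [← h]
  congr 1
  ext w
  exact ⟨fun hw => ⟨hw.1, lt_of_le_of_lt hw.1 ENNReal.coe_lt_top, hw.2⟩,
    fun hw => ⟨hw.1, hw.2.2⟩⟩

/-- The hitting time of `y` is independent of the path after that time, which has law `P y`. -/
theorem IsStrongMarkovProcess.map_hittingTime_shift (hP : IsStrongMarkovProcess P) (x y : T) :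
    ((P x).restrict {w | hittingTime y w < ∞}).map
        (fun w => ((hittingTime y w).toNNReal, shift (hittingTime y w).toNNReal w)) =
      (((P x).restrict {w | hittingTime y w < ∞}).map
        fun w => (hittingTime y w).toNNReal).prod (P y) := by
  have := hP.isMarkovKernel
  set μ := (P x).restrict {w | hittingTime y w < ∞} with hμ
  have hτ : AEMeasurable (fun w => (hittingTime y w).toNNReal) μ :=
    (aemeasurable_hittingTime μ y).ennreal_toNNReal
  have hθ := aemeasurable_shift_hittingTime μ y
  have hn := nullMeasurableSet_hittingTime_lt_top (P x) y
  refine (Measure.prod_eq fun S B hS hB => ?_).symm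
  have hnB : NullMeasurableSet {w | shift (hittingTime y w).toNNReal w ∈ B} μ :=
    hθ.nullMeasurable hB
  -- For fixed B both sides are finite measures in the hitting time, so half-lines suffice, where
  -- the strong Markov property gives the product.
  have key : (μ.restrict {w | shift (hittingTime y w).toNNReal w ∈ B}).map
      (fun w => (hittingTime y w).toNNReal) =
      P y B • μ.map fun w => (hittingTime y w).toNNReal := by
    refine Measure.ext_of_Iic _ _ fun s => ?_
    have hnS : NullMeasurableSet {w | hittingTime y w ≤ s} (P x) :=
      nullMeasurableSet_of_augmented (isStopping_hittingTime (P x) y s)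
    have hS' : (fun w => (hittingTime y w).toNNReal) ⁻¹' Iic s ∩ {w | hittingTime y w < ∞} =
        {w : RCPath T | hittingTime y w ≤ s} := by
      ext w
      simp only [mem_inter_iff, mem_preimage, mem_Iic, mem_ofPred_eq]
      constructor
      · rintro ⟨h1, h2⟩
        rw [← ENNReal.coe_toNNReal h2.ne]
        exact_mod_cast h1
      · intro h1
        have h2 := lt_of_le_of_lt h1 ENNReal.coe_lt_top
        rw [← ENNReal.coe_toNNReal h2.ne] at h1
        exact ⟨by exact_mod_cast h1, h2⟩
    rw [Measure.map_apply_of_aemeasurable (hτ.mono_measure Measure.restrict_le_self)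
      measurableSet_Iic, Measure.smul_apply, Measure.map_apply_of_aemeasurable hτ measurableSet_Iic,
      Measure.restrict_apply₀' hnB, hμ, Measure.restrict_apply₀' hn, Measure.restrict_apply₀' hn,
      hS', inter_right_comm, hS', smul_eq_mul, mul_comm, ← hP.measure_hittingTime_le x y s hB]
    rfl
  have hSB := congrArg (fun ρ : Measure ℝ≥0 => ρ S) key
  simp only [Measure.smul_apply, smul_eq_mul] at hSB
  rw [Measure.map_apply_of_aemeasurable (hτ.mono_measure Measure.restrict_le_self) hS,
    Measure.restrict_apply₀' (hnB)] at hSB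
  rw [Measure.map_apply_of_aemeasurable (hτ.prodMk hθ) (hS.prod hB), mul_comm, ← hSB]
  rfl

theorem IsStrongMarkovProcess.lintegral_shift_hittingTime (hP : IsStrongMarkovProcess P) (a : ℝ)
    (x y : T) {Φ : RCPath T → ℝ≥0∞} (hΦ : Measurable Φ) :
    ∫⁻ w in {w | hittingTime y w < ∞},
        ENNReal.ofReal (Real.exp (-(a * (hittingTime y w).toNNReal))) *
          Φ (shift (hittingTime y w).toNNReal w) ∂(P x) =
      hittingLaplace a P x y * ∫⁻ w, Φ w ∂(P y) := by
  have := hP.isMarkovKernel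
  set μ := (P x).restrict {w | hittingTime y w < ∞} with hμ
  have hτ : AEMeasurable (fun w => (hittingTime y w).toNNReal) μ :=
    (aemeasurable_hittingTime μ y).ennreal_toNNReal
  have hm : Measurable fun q : ℝ≥0 × RCPath T =>
      ENNReal.ofReal (Real.exp (-(a * q.1))) * Φ q.2 :=
    ((measurable_ofReal_exp a).comp measurable_fst).mul (hΦ.comp measurable_snd)
  rw [hittingLaplace, ← lintegral_map' (measurable_ofReal_exp a).aemeasurable hτ,
    ← lintegral_prod_mul (measurable_ofReal_exp a).aemeasurable hΦ.aemeasurable,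
    ← hP.map_hittingTime_shift x y,
    lintegral_map' hm.aemeasurable (hτ.prodMk (aemeasurable_shift_hittingTime μ y))]

/-- Right-continuity forces a positive time to reach `y` from `x ≠ y`, so the discount factor is
almost surely below 1. -/
theorem IsStrongMarkovProcess.hittingLaplace_lt_one (hP : IsStrongMarkovProcess P) {a : ℝ}
    (ha : 0 < a) {x y : T} (hxy : x ≠ y) : hittingLaplace a P x y < 1 := by
  have := hP.isMarkovKernel
  refine lt_of_le_of_ne (hittingLaplace_le_one ha x y) fun h1 => ?_
  set F : RCPath T → ℝ≥0∞ := {w | hittingTime y w < ∞}.indicator fun w =>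
    ENNReal.ofReal (Real.exp (-(a * (hittingTime y w).toNNReal))) with hF
  have hn := nullMeasurableSet_hittingTime_lt_top (P x) y
  have hFm : AEMeasurable F (P x) :=
    AEMeasurable.indicator₀ ((measurable_ofReal_exp a).comp_aemeasurable
      (aemeasurable_hittingTime (P x) y).ennreal_toNNReal) hn
  have hlt : ∀ᵐ w ∂(P x), F w < 1 := by
    filter_upwards [hP.start x] with w hw
    have hpos : 0 < hittingTime y w := hittingTime_pos (by rwa [hw])
    by_cases hfin : hittingTime y w < ∞
    · have hpos' : (0 : ℝ) < (hittingTime y w).toNNReal := by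
        exact_mod_cast ENNReal.toNNReal_pos hpos.ne' hfin.ne
      have hmem : w ∈ {w | hittingTime y w < ∞} := hfin
      rw [hF, indicator_of_mem hmem, ENNReal.ofReal_lt_one, Real.exp_lt_one_iff]
      exact neg_neg_of_pos (mul_pos ha hpos')
    · have hmem : w ∉ {w | hittingTime y w < ∞} := hfin
      rw [hF, indicator_of_notMem hmem]
      exact one_pos
  have hint : ∫⁻ w, F w ∂(P x) = 1 := by
    rw [hF, lintegral_indicator₀ hn]
    exact h1
  have hstrict : ∫⁻ w, F w ∂(P x) < ∫⁻ _, 1 ∂(P x) :=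
    lintegral_strict_mono (IsProbabilityMeasure.ne_zero _) aemeasurable_const (by simp [hint]) hlt
  simp [hint] at hstrict

theorem IsStrongMarkovProcess.markovResolvent_eq (hP : IsStrongMarkovProcess P) (a : ℝ)
    {f : T → ℝ≥0∞} (hf : Measurable f) (x y : T) :
    markovResolvent a P f x = ∫⁻ z, f z ∂killedOccupation (expTime a) P y x +
      hittingLaplace a P x y * markovResolvent a P f y := by
  have := hP.isMarkovKernel
  have hfu : UniversallyMeasurable f := .of_measurable hf
  rw [lintegral_killedOccupation' _ y x hfu, markovResolvent, markovResolvent,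
    ← hP.lintegral_shift_hittingTime a x y (measurable_lintegral_expTime a hf),
    ← lintegral_indicator₀ (nullMeasurableSet_hittingTime_lt_top (P x) y),
    ← lintegral_add_left' (universallyMeasurable_lintegral_killedValue _ y hfu _)]
  exact lintegral_congr fun w => lintegral_expTime_eq_killedValue_add a y hf w

/-- For f = 1 the unkilled resolvent is the total mass of `expTime a` for either process, so the
mass of the killed resolvent fixes the Laplace transform. -/
theorem hittingLaplace_congr (hP : IsStrongMarkovProcess P) (hQ : IsStrongMarkovProcess Q)
    {a : ℝ} (ha : 0 < a) {x y : T}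
    (h : killedOccupation (expTime a) P y x = killedOccupation (expTime a) Q y x) :
    hittingLaplace a P x y = hittingLaplace a Q x y := by
  have := hP.isMarkovKernel
  have := hQ.isMarkovKernel
  have := isFiniteMeasure_expTime ha
  have eP := hP.markovResolvent_eq a (measurable_const (a := 1)) x y
  have eQ := hQ.markovResolvent_eq a (measurable_const (a := 1)) x y
  rw [markovResolvent_const, markovResolvent_const, one_mul] at eP eQ
  rw [← h] at eQ
  have hne : ∫⁻ _, 1 ∂killedOccupation (expTime a) P y x ≠ ∞ :=
    ne_top_of_le_ne_top (measure_ne_top (expTime a) univ) (eP ▸ le_self_add)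
  have h2 := (ENNReal.add_right_inj hne).mp (eP.symm.trans eQ)
  have h0 : expTime a univ ≠ 0 := fun h0 =>
    expTime_Ioc_ne_zero ha (one_pos (α := ℝ≥0)) (measure_mono_null (subset_univ _) h0)
  exact (ENNReal.mul_left_inj h0 (measure_ne_top _ _)).mp h2

/-- The processes killed at two different points determine the resolvent. -/
theorem markovResolvent_congr (hP : IsStrongMarkovProcess P) (hQ : IsStrongMarkovProcess Q)
    {a : ℝ} (ha : 0 < a)
    (h : ∀ x y, killedOccupation (expTime a) P y x = killedOccupation (expTime a) Q y x)
    {f : T → ℝ≥0∞} (hf : Measurable f) {C : ℝ≥0∞} (hC : C ≠ ∞) (hfC : ∀ z, f z ≤ C) {x z : T}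
    (hxz : x ≠ z) : markovResolvent a P f x = markovResolvent a Q f x := by
  have := hP.isMarkovKernel
  have := hQ.isMarkovKernel
  have := isFiniteMeasure_expTime ha
  have hfin : ∀ (R : Kernel T (RCPath T)) [IsMarkovKernel R], markovResolvent a R f x ≠ ∞ :=
    fun R _ => ne_top_of_le_ne_top (ENNReal.mul_ne_top hC (measure_ne_top (expTime a) univ))
      ((lintegral_mono fun w => lintegral_mono fun t => hfC _).trans_eq
        (markovResolvent_const a C x))
  -- A round trip from x to z and back closes the decomposition into an equation for the resolvent
  -- at x alone.
  have e : ∀ {R : Kernel T (RCPath T)}, IsStrongMarkovProcess R → markovResolvent a R f x =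
      (∫⁻ u, f u ∂killedOccupation (expTime a) R z x + hittingLaplace a R x z *
        ∫⁻ u, f u ∂killedOccupation (expTime a) R x z) +
      (hittingLaplace a R x z * hittingLaplace a R z x) * markovResolvent a R f x := fun hR => by
    conv_lhs => rw [hR.markovResolvent_eq a hf x z, hR.markovResolvent_eq a hf z x]
    ring
  have eP := e hP
  have eQ := e hQ
  rw [← h, ← h, ← hittingLaplace_congr hP hQ ha (h x z), ← hittingLaplace_congr hP hQ ha (h z x)]
    at eQ
  refine ENNReal.eq_of_eq_add_mul ?_ (hfin P) (hfin Q) eP eQ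
  calc hittingLaplace a P x z * hittingLaplace a P z x
      ≤ hittingLaplace a P x z * 1 := by gcongr; exact hittingLaplace_le_one ha z x
    _ < 1 := by rw [mul_one]; exact hP.hittingLaplace_lt_one ha hxz

end StrongMarkov

end

/-! ### Conclusion -/

theorem proposition4p1 {T : Type*} [MetricSpace T] [CompactSpace T] [MeasurableSpace T]
    [BorelSpace T] (_hT : IsMetricTree T)
    (ν : Measure T) [IsFiniteMeasure ν] [ν.IsOpenPosMeasure]
    (P Q : Kernel T (RCPath T))
    (hP : IsStrongMarkovProcess P) (hQ : IsStrongMarkovProcess Q)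
    (hocc : ∀ (x y : T) (f : T → ℝ≥0), Measurable f → (∃ C : ℝ≥0, ∀ z, f z ≤ C) →
      expectedOccupation P x y f = expectedOccupation Q x y f)
    (htrans : ∀ y : T, IsTransientUntilHitting P y) :
    ∀ x : T, P x = Q x := by
  have := hP.isMarkovKernel
  have := hQ.isMarkovKernel
  refine hP.ext_of_map_eval hQ fun x => ?_
  by_cases hx : ∃ z, x ≠ z
  · obtain ⟨z, hxz⟩ := hx
    refine map_eval_congr fun a ha f => ?_
    refine markovResolvent_congr hP hQ ha (fun x y => killedOccupation_expTime_congr hP hQ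
      (fun x => killedOccupation_timeMeasure_congr (hocc x y)) (htrans y) ha x)
      f.continuous.measurable.coe_nnreal_ennreal (C := nndist f 0) ENNReal.coe_ne_top
      (fun u => ?_) hxz
    exact ENNReal.coe_le_coe.mpr
      (by simpa using BoundedContinuousFunction.nndist_coe_le_nndist (f := f) (g := 0) u)
  -- Without a second point there is no round trip, but on a one-point space the marginals are
  -- determined by their total mass.
  · push Not at hx
    have : Subsingleton T := ⟨fun u v => (hx u).symm.trans (hx v)⟩
    intro t
    ext B hB
    rw [Measure.map_apply (RCPath.measurable_eval t) hB,
      Measure.map_apply (RCPath.measurable_eval t) hB]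
    rcases Set.eq_empty_or_nonempty B with rfl | hne
    · simp
    · simp [Subsingleton.eq_univ_of_nonempty hne]
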